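/- **Notation.** $\|\cdot\|_2$ is the Euclidean norm of a vector and the spectral norm of a matrix; $\langle r\rangle=\max(1,|r|)$; $\mathrm{cov}[U,V]=\mathrm{E}[(U-\mathrm{E}U)(V-\mathrm{E}V)^\top]$, $\mathrm{var}(U)=\mathrm{cov}[U,U]$; $\ell_{2,p}$ is the Hilbert space of square summable sequences $(v_t)_{t\in\mathbb Z}$ in $\mathbb R^p$; $N$ ranges over the positive integers. **Setting.** Let $\{\varepsilon_t\}_{t\in\mathbb Z}$ be iid random vectors of dimension $p$, and let $\{\widetilde\varepsilon_t\}_{t\in\mathbb Z}$ be iid with the same distribution and independent of $\{\varepsilon_t\}$. Put $\mathcal F_t=(\varepsilon_t,\varepsilon_{t-1},\ldots)$ and, for $j\ge 0$, let $\mathcal F_{t|\{t-j\}}=(\varepsilon_t,\ldots,\varepsilon_{t-j+1},\widetilde\varepsilon_{t-j},\varepsilon_{t-j-1},\ldots)$. Let $X_{t,N}=G_{t,N}(\mathcal F_t)$ be a zero mean, square integrable time series of dimension $p$ and, for $u\in\mathbb R$, let $X_t(u)=G(u,\mathcal F_t)$ be square integrable of dimension $p$, where $G_{t,N}$ and $G(u,\cdot)$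 are measurable. For a variable $V_t=g_t(\mathcal F_t)$ write $V_{t|\{t-j\}}=g_t(\mathcal F_{t|\{t-j\}})$; this applies to $X_{t,N}$, to $X_t(u)$, to $X_t^{v_1,v_2}=X_t(v_1)-X_t(v_2)$ and to $e_{t,N}=X_{t,N}-X_t(t/N)$. Put $C^{(N)}_{t,\tau}=\mathrm{cov}[X_{t,N},X_{\tau,N}]$, $C_r(u)=\mathrm{cov}[X_r(u),X_0(u)]$ and $f(\omega;u)=\sum_{r\in\mathbb Z}C_r(u)e^{ir\omega}$. **Theorem.** Suppose that there are $\kappa>3$ and a finite constant $K$ such that, with $\delta_j=\langle j\rangle^{-\kappa}$, for all $j\ge0$, $N\geq 1$, $t\in\mathbb Z$, $u,v_1,v_2\in\mathbb R$: (A) $\|\mathrm{var}(X_{t,N}-X_{t,N|\{t-j\}})\|_2^{1/2}\le K\delta_j$, $\ \|\mathrm{var}(X_t(u)-X_{t|\{t-j\}}(u))\|_2^{1/2}\le K\delta_j$, $\ \|\mathrm{var}(X_t^{v_1,v_2}-X^{v_1,v_2}_{t|\{t-j\}})\|_2^{1/2}\le K|v_1-v_2|\delta_j$, $\ \|\mathrm{var}(e_{t,N}-e_{t,N|\{t-j\}})\|_2^{1/2}\le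 KN^{-1}\delta_j$. (B) The eigenvalues of the matrices $f(\omega;u)$ are bounded away from $0$ and $\infty$: there are $0<\gamma_{\inf}\le\gamma_{\sup}<\infty$ such that all eigenvalues of $f(\omega;u)$ lie in $[\gamma_{\inf},\gamma_{\sup}]$ for all $u,\omega\in\mathbb R$. Then the following hold. (i) There are $N_0\ge1$ and $0<\lambda_{\inf}\le\lambda_{\sup}<\infty$ such that for every $N\ge N_0$ the matrix $\mathbf C^{(N)}=(C^{(N)}_{t,\tau})_{t,\tau\in\mathbb Z}$ defines a bounded operator on $\ell_{2,p}$, $(\mathbf C^{(N)}v)_t=\sum_\tau C^{(N)}_{t,\tau}v_\tau$, and $\lambda_{\inf}\le\langle v,\mathbf C^{(N)}v\rangle\le\lambda_{\sup}$ for all $v\in\ell_{2,p}$ with $\|v\|_2=1$. Moreover, there is a finite constant $K'>0$ such that, with the same $\kappa$, (ii) $\|C^{(N)}_{t,\tau}\|_2\le K'\langle t-\tau\rangle^{-\kappa}$ for all $N\ge 1$ and $t,\tau\in\mathbb Z$; (iii) for all $r,t,\tau\in\mathbb Z$, $u,v\in\mathbb R$ and $N\geq 1$: (a) $C_r(u)=C_{-r}(u)^\top$;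 (b) $\|C_r(u)\|_2\le K'\langle r\rangle^{-\kappa}$; (c) $\|C_r(u)-C_r(v)\|_2\le K'|u-v|\langle r\rangle^{-\kappa}$; and $$\|C^{(N)}_{t,\tau}-C_{t-\tau}(t/N)\|_2\le\frac{K'}{\langle t-\tau\rangle^{\kappa-1}}\min\Big(\frac1N,\frac{2}{\langle t-\tau\rangle}\Big).$$ -/

import Mathlib

open MeasureTheory ProbabilityTheory

/-- The space `ℝ^p` with the Euclidean norm. -/
abbrev Vec (p : ℕ) : Type := EuclideanSpace ℝ (Fin p)

/-- Real `p × p` matrices. -/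
abbrev Mat (p : ℕ) : Type := Matrix (Fin p) (Fin p) ℝ

/-- The sequence space `ℓ_{2,p}` of square summable sequences `(v_t)_{t ∈ ℤ}` in `ℝ^p`. -/
abbrev SeqSpace (p : ℕ) : Type := lp (fun _ : ℤ => Vec p) 2

/-- The spectral norm `‖A‖₂`: the operator norm induced by the Euclidean norm. -/
noncomputable def specNorm {p : ℕ} (A : Mat p) : ℝ :=
  ‖Matrix.toEuclideanCLM (n := Fin p) (𝕜 := ℝ) A‖

/-- `⟨r⟩ = max(1, |r|)`. -/
noncomputable def gu (r : ℤ) : ℝ := max 1 |(r : ℝ)|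

/-- The covariance matrix `cov[U, V] = E[(U - E U)(V - E V)ᵀ]` of two random vectors. -/
noncomputable def covMat {p : ℕ} {Ω : Type*} [MeasurableSpace Ω] (P : Measure Ω)
    (U V : Ω → Vec p) : Mat p :=
  Matrix.of fun a b => covariance (fun ω => U ω a) (fun ω => V ω b) P

/-- The variance matrix `var(U) = cov[U, U]`. -/
noncomputable def varMat {p : ℕ} {Ω : Type*} [MeasurableSpace Ω] (P : Measure Ω)
    (U : Ω → Vec p) : Mat p :=
  covMat P U U

/-- The innovation history `F_t = (ε_t, ε_{t-1}, ε_{t-2}, …)`. -/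
def past {p : ℕ} {Ω : Type*} (ε : ℤ → Ω → Vec p) (t : ℤ) (ω : Ω) : ℕ → Vec p :=
  fun i => ε (t - i) ω

/-- The coupled history
`F_{t|{t-j}} = (ε_t, …, ε_{t-j+1}, ε'_{t-j}, ε_{t-j-1}, …)`. -/
def coupledPast {p : ℕ} {Ω : Type*} (ε ε' : ℤ → Ω → Vec p) (t : ℤ) (j : ℕ) (ω : Ω) :
    ℕ → Vec p :=
  fun i => if i = j then ε' (t - j) ω else ε (t - i) ω

/-- The families `(ε_t)` and `(ε'_t)` each consist of iid random vectors, have the same marginal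
distribution, and are independent of one another: all the vectors `ε_t`, `ε'_s` together form one
iid family. -/
structure IIDWithCopy {p : ℕ} {Ω : Type*} [MeasurableSpace Ω] (P : Measure Ω)
    (ε ε' : ℤ → Ω → Vec p) : Prop where
  measurable : ∀ t, Measurable (ε t)
  measurable_copy : ∀ t, Measurable (ε' t)
  indep : iIndepFun (Sum.elim ε ε' : ℤ ⊕ ℤ → Ω → Vec p) P
  ident : ∀ t, IdentDistrib (ε t) (ε 0) P P
  ident_copy : ∀ t, IdentDistrib (ε' t) (ε 0) P P

/-- The spectral-norm physical dependence of the causal variable `g(F_t)` at lag `j`: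
`‖var(g(F_t) - g(F_{t|{t-j}}))‖₂^{1/2}`. -/
noncomputable def physDep {p : ℕ} {Ω : Type*} [MeasurableSpace Ω] (P : Measure Ω)
    (ε ε' : ℤ → Ω → Vec p) (g : (ℕ → Vec p) → Vec p) (t : ℤ) (j : ℕ) : ℝ :=
  Real.sqrt (specNorm (varMat P fun ω => g (past ε t ω) - g (coupledPast ε ε' t j ω)))

/-- The spectral density matrix `f(ω) = ∑_{r ∈ ℤ} C_r exp(i r ω)`. -/
noncomputable def spectralDensity {p : ℕ} (C : ℤ → Mat p) (ω : ℝ) :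
    Matrix (Fin p) (Fin p) ℂ :=
  ∑' r : ℤ, Complex.exp (Complex.I * (r : ℂ) * (ω : ℂ)) • (C r).map (fun x : ℝ => (x : ℂ))

/-- The bounded operator `T` on `ℓ_{2,p}` is the one given by the bi-infinite block matrix
`(C_{t,τ})`: `(T v)_t = ∑_τ C_{t,τ} v_τ`, all these series being convergent. -/
def IsBlockMatrixOf {p : ℕ} (C : ℤ → ℤ → Mat p) (T : SeqSpace p →L[ℝ] SeqSpace p) : Prop :=
  ∀ (v : SeqSpace p) (t : ℤ),
    HasSum (fun τ : ℤ => Matrix.toEuclideanCLM (n := Fin p) (𝕜 := ℝ) (C t τ) (v τ)) (T v t)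

/-- Eigenvalue condition for an array `C^{(N)}` of covariance operators, from `N₀` on:
`0 < a ≤ λ_inf(C^{(N)}) ≤ λ_sup(C^{(N)}) ≤ b` for all `N ≥ N₀`, where `λ_inf` and `λ_sup` are the
infimum and the supremum of `⟨v, C^{(N)} v⟩` over the unit sphere of `ℓ_{2,p}`. -/
def EigenvalueCondition {p : ℕ} (CN : ℕ → ℤ → ℤ → Mat p) (N₀ : ℕ) (a b : ℝ) : Prop :=
  1 ≤ N₀ ∧ 0 < a ∧ ∀ N : ℕ, N₀ ≤ N →
    ∃ T : SeqSpace p →L[ℝ] SeqSpace p, IsBlockMatrixOf (CN N) T ∧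
      ∀ v : SeqSpace p, ‖v‖ = 1 → a ≤ inner ℝ v (T v) ∧ inner ℝ v (T v) ≤ b

/-- Covariance decay condition: `‖C^{(N)}_{t,τ}‖₂ ≤ K / ⟨t-τ⟩^κ`. -/
def CovarianceDecay {p : ℕ} (CN : ℕ → ℤ → ℤ → Mat p) (K κ : ℝ) : Prop :=
  ∀ N : ℕ, 1 ≤ N → ∀ t τ : ℤ, specNorm (CN N t τ) ≤ K / gu (t - τ) ^ κ

/-- Smoothness condition for the array `C^{(N)}` with the approximating matrix functions
`C_r(u)`. -/
structure SmoothnessCondition {p : ℕ} (CN : ℕ → ℤ → ℤ → Mat p) (C : ℤ → ℝ → Mat p)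
    (K κ : ℝ) : Prop where
  symm : ∀ (r : ℤ) (u : ℝ), C r u = (C (-r) u).transpose
  decay : ∀ (r : ℤ) (u : ℝ), specNorm (C r u) ≤ K / gu r ^ κ
  lipschitz : ∀ (r : ℤ) (u v : ℝ), specNorm (C r u - C r v) ≤ K * |u - v| / gu r ^ κ
  approx : ∀ N : ℕ, 1 ≤ N → ∀ t τ : ℤ,
    specNorm (CN N t τ - C (t - τ) ((t : ℝ) / (N : ℝ))) ≤
      K / gu (t - τ) ^ (κ - 1) * min (1 / (N : ℝ)) (2 / gu (t - τ))

/-! Covariances are controlled by replacing innovations one at a time. Interpolate from `Ψ(ε)` to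
`Ψ(ε')`, which is independent of `Φ(ε)`; the covariance of `Φ(ε)` and `Ψ(ε)` then telescopes.
Exchanging `ε_s` with its copy preserves the joint law and reverses the sign of the increment at
`s`, so the increment pairs with half the effect on `Φ` of replacing `ε_s`, and Cauchy–Schwarz
applies (`abs_covariance_le_of_sum_sqDep_le`). By causality only `s ≤ min t τ` counts, and
convolving the weights gives the decay `⟨t-τ⟩^{-κ}` (`specNorm_covMat_le`). This bound is linear in
the dependence constant of each argument, so bilinearity of the covariance turns small dependence of
differences of processes into the Lipschitz and approximation bounds
(`covarianceDecay_and_smoothness`).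

The operator and its upper bound come from a Schur test. For the lower bound, average the Toeplitz
forms with symbols `f(·; s/N)`, each cut off to a window of length `L` at `s`. Each form is bounded
below by `γ` (`toeplitz_lower_bound`), hence so is the average, as every `t` lies in exactly `L`
windows. The array differs from the average by at most a constant times `(1/L + (1+L)/N)
⟨t-τ⟩^{1-κ}`, which is summable along diagonals; a large `L`, and then a large `N`, leave at least
`γ/2`. -/

open Filter Topology

/-! ### Cauchy–Schwarz in `L²` -/

section SecondMoment

variable {Ω : Type*} [MeasurableSpace Ω] {P : Measure Ω}

/-- Cauchy–Schwarz for square integrable real random variables. -/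
theorem abs_integral_mul_le_sqrt_mul_sqrt {f g : Ω → ℝ} (hf : MemLp f 2 P) (hg : MemLp g 2 P) :
    |∫ ω, f ω * g ω ∂P| ≤ √(∫ ω, f ω ^ 2 ∂P) * √(∫ ω, g ω ^ 2 ∂P) := by
  have h := integral_mul_norm_le_Lp_mul_Lq (μ := P) (E := ℝ) (f := f) (g := g)
    (Real.HolderConjugate.two_two) (by simpa using hf) (by simpa using hg)
  calc |∫ ω, f ω * g ω ∂P| ≤ ∫ ω, ‖f ω‖ * ‖g ω‖ ∂P := by
        refine (norm_integral_le_integral_norm (fun ω => f ω * g ω)).trans_eq ?_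
        simp
    _ ≤ _ := h
    _ = _ := by simp [Real.sqrt_eq_rpow]

end SecondMoment

/-! ### Relabelling iid families -/

section IID

variable {ι κ E Ω : Type*} [MeasurableSpace E] [MeasurableSpace Ω] {P : Measure Ω}
  {ζ : ι → Ω → E}

/-- Two injective relabellings of an iid family have the same joint law. -/
theorem identDistrib_reindex (hm : ∀ i, Measurable (ζ i)) (hi : iIndepFun ζ P)
    (hd : ∀ i j, IdentDistrib (ζ i) (ζ j) P P) {f g : κ → ι} (hf : f.Injective)
    (hg : g.Injective) :
    IdentDistrib (fun ω k => ζ (f k) ω) (fun ω k => ζ (g k) ω) P P where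
  aemeasurable_fst := (measurable_pi_iff.2 fun k => hm _).aemeasurable
  aemeasurable_snd := (measurable_pi_iff.2 fun k => hm _).aemeasurable
  map_eq := by
    have h1 := (hi.precomp hf).map_fun_eq_infinitePi_map (fun k => hm (f k))
    have h2 := (hi.precomp hg).map_fun_eq_infinitePi_map (fun k => hm (g k))
    rw [h1, h2]
    congr 1
    funext k
    exact (hd _ _).map_eq

/-- Two disjoint relabellings of an independent family are independent. -/
theorem indepFun_reindex {κ' : Type*} (hm : ∀ i, Measurable (ζ i)) (hi : iIndepFun ζ P)
    {f : κ → ι} {g : κ' → ι} (hfg : ∀ k l, f k ≠ g l) :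
    IndepFun (fun ω k => ζ (f k) ω) (fun ω l => ζ (g l) ω) P := by
  have h := indep_iSup_of_disjoint (m := fun i => MeasurableSpace.comap (ζ i) inferInstance)
    (fun i => (hm i).comap_le) hi (S := Set.range f) (T := Set.range g)
    (Set.disjoint_left.2 (by rintro _ ⟨k, rfl⟩ ⟨l, hl⟩; exact hfg k l hl.symm))
  rw [IndepFun_iff_Indep]
  refine indep_of_indep_of_le_left (indep_of_indep_of_le_right h ?_) ?_
  · simp only [MeasurableSpace.pi, MeasurableSpace.comap_iSup, MeasurableSpace.comap_comp]
    exact iSup_le fun l => le_iSup₂_of_le (g l) ⟨l, rfl⟩ le_rfl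
  · simp only [MeasurableSpace.pi, MeasurableSpace.comap_iSup, MeasurableSpace.comap_comp]
    exact iSup_le fun l => le_iSup₂_of_le (f l) ⟨l, rfl⟩ le_rfl

/-- If the relabellings `f n` converge pointwise to `g`, then a square integrable function of the
relabelled family converges weakly in `L²`. -/
theorem tendsto_integral_mul_reindex [TopologicalSpace E] [PolishSpace E] [BorelSpace E]
    [Countable κ] [IsProbabilityMeasure P] (hm : ∀ i, Measurable (ζ i)) (hi : iIndepFun ζ P)
    (hd : ∀ i j, IdentDistrib (ζ i) (ζ j) P P) {f : ℕ → κ → ι} {g : κ → ι}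
    (hf : ∀ n, (f n).Injective) (hg : g.Injective) (hfg : ∀ k, ∀ᶠ n in atTop, f n k = g k)
    {Ψ : (κ → E) → ℝ} (hΨ : Measurable Ψ) (hΨ2 : MemLp (fun ω => Ψ fun k => ζ (g k) ω) 2 P)
    {Z : Ω → ℝ} (hZ : MemLp Z 2 P) :
    Tendsto (fun n => ∫ ω, Z ω * Ψ (fun k => ζ (f n k) ω) ∂P) atTop
      (𝓝 (∫ ω, Z ω * Ψ (fun k => ζ (g k) ω) ∂P)) := by
  have hmg : Measurable (fun ω k => ζ (g k) ω) := measurable_pi_iff.2 fun k => hm _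
  have hid : ∀ n, IdentDistrib (fun ω k => ζ (g k) ω) (fun ω k => ζ (f n k) ω) P P :=
    fun n => identDistrib_reindex hm hi hd hg (hf n)
  have hΨf : ∀ n, MemLp (fun ω => Ψ fun k => ζ (f n k) ω) 2 P :=
    fun n => (((hid n).comp hΨ).memLp_iff).1 hΨ2
  set A : ℝ := √(∫ ω, Z ω ^ 2 ∂P) with hA
  have hA0 : 0 ≤ A := Real.sqrt_nonneg _
  rw [Metric.tendsto_atTop]
  intro e he
  -- Replacing `Ψ` by `b` happens twice and costs at most `A * d < e / 3` each time; `A + 1` avoids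
  -- division by zero.
  set d : ℝ := e / (3 * (A + 1)) with hd'
  have hd0 : 0 < d := by positivity
  have hprob : IsProbabilityMeasure (P.map fun ω k => ζ (g k) ω) :=
    Measure.isProbabilityMeasure_map hmg.aemeasurable
  have hΨμ : MemLp Ψ (ENNReal.ofReal 2) (P.map fun ω k => ζ (g k) ω) := by
    rw [memLp_map_measure_iff hΨ.aestronglyMeasurable hmg.aemeasurable]
    simpa [Function.comp_def] using hΨ2
  -- All the relabelled families have the same law, so a single bounded continuous `b` approximates
  -- `Ψ` equally well along every `f n`.
  obtain ⟨b, hb, hb2⟩ := hΨμ.exists_boundedContinuous_integral_rpow_sub_le (by norm_num)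
    (show (0 : ℝ) < d ^ 2 by positivity)
  have hbm : Measurable (b : (κ → E) → ℝ) := b.continuous.measurable
  have hbg : ∫ ω, (Ψ (fun k => ζ (g k) ω) - b (fun k => ζ (g k) ω)) ^ 2 ∂P ≤ d ^ 2 := by
    simp only [Real.rpow_two, Real.norm_eq_abs, sq_abs] at hb
    rwa [integral_map hmg.aemeasurable (by fun_prop)] at hb
  have hb2g : MemLp (fun ω => b fun k => ζ (g k) ω) 2 P := by
    rw [memLp_map_measure_iff hbm.aestronglyMeasurable hmg.aemeasurable] at hb2
    simpa [Function.comp_def] using hb2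
  have hb2f : ∀ n, MemLp (fun ω => b fun k => ζ (f n k) ω) 2 P :=
    fun n => (((hid n).comp hbm).memLp_iff).1 hb2g
  have hbf : ∀ n, ∫ ω, (Ψ (fun k => ζ (f n k) ω) - b (fun k => ζ (f n k) ω)) ^ 2 ∂P ≤ d ^ 2 := by
    intro n
    refine le_trans (le_of_eq ?_) hbg
    exact ((hid n).comp (u := fun x => (Ψ x - b x) ^ 2) (by fun_prop)).integral_eq.symm
  have hdct : Tendsto (fun n => ∫ ω, Z ω * b (fun k => ζ (f n k) ω) ∂P) atTop
      (𝓝 (∫ ω, Z ω * b (fun k => ζ (g k) ω) ∂P)) := by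
    refine tendsto_integral_of_dominated_convergence (fun ω => ‖Z ω‖ * ‖b‖) ?_ ?_ ?_ ?_
    · exact fun n => hZ.1.mul (hb2f n).1
    · exact ((hZ.integrable (by norm_num)).norm).mul_const _
    · intro n
      refine Eventually.of_forall fun ω => ?_
      rw [norm_mul]
      exact mul_le_mul_of_nonneg_left (b.norm_coe_le_norm _) (norm_nonneg _)
    · refine Eventually.of_forall fun ω => ?_
      refine Tendsto.const_mul _ ((b.continuous.tendsto _).comp ?_)
      rw [tendsto_pi_nhds]
      intro k
      refine tendsto_const_nhds.congr' ?_
      filter_upwards [hfg k] with n hn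
      rw [hn]
  obtain ⟨n0, hn0⟩ := (Metric.tendsto_atTop.1 hdct) (e / 3) (by positivity)
  refine ⟨n0, fun n hn => ?_⟩
  have h2 := hn0 n hn
  have hle : ∀ h : κ → ι, MemLp (fun ω => Ψ fun k => ζ (h k) ω) 2 P →
      MemLp (fun ω => b fun k => ζ (h k) ω) 2 P →
      ∫ ω, (Ψ (fun k => ζ (h k) ω) - b (fun k => ζ (h k) ω)) ^ 2 ∂P ≤ d ^ 2 →
      |∫ ω, Z ω * Ψ (fun k => ζ (h k) ω) ∂P - ∫ ω, Z ω * b (fun k => ζ (h k) ω) ∂P| < e / 3 := by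
    intro h h1 h2 h3
    have hs := integral_sub (hZ.integrable_mul h1) (hZ.integrable_mul h2)
    simp only [Pi.mul_apply, ← mul_sub] at hs
    rw [← hs]
    calc _ ≤ A * √(∫ ω, (Ψ (fun k => ζ (h k) ω) - b (fun k => ζ (h k) ω)) ^ 2 ∂P) :=
          abs_integral_mul_le_sqrt_mul_sqrt hZ (h1.sub h2)
      _ ≤ A * d := by
          gcongr
          exact Real.sqrt_le_iff.2 ⟨hd0.le, h3⟩
      _ < (A + 1) * d := by nlinarith
      _ = e / 3 := by rw [hd']; field_simp
  have e1 := abs_lt.1 (hle (f n) (hΨf n) (hb2f n) (hbf n))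
  have e2 := abs_lt.1 (hle g hΨ2 hb2g hbg)
  rw [Real.dist_eq, abs_lt] at h2 ⊢
  constructor <;> linarith [h2.1, h2.2, e1.1, e1.2, e2.1, e2.2]

end IID

/-! ### Covariances by interpolation between the innovations and their copies -/

section CovarianceBound

variable {E Ω : Type*} [MeasurableSpace E] [MeasurableSpace Ω] {P : Measure Ω}

/-- The relabelling that selects the copy exactly at time `s`. -/
def copyAt (s i : ℤ) : ℤ ⊕ ℤ := if i = s then Sum.inr i else Sum.inl i

/-- The relabelling that selects the copy from time `s` on. -/
def copyFrom (s i : ℤ) : ℤ ⊕ ℤ := if s ≤ i then Sum.inr i else Sum.inl i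

theorem copyAt_injective (s : ℤ) : (copyAt s).Injective := by
  intro i j h
  unfold copyAt at h
  split_ifs at h <;> simp_all

theorem copyFrom_injective (s : ℤ) : (copyFrom s).Injective := by
  intro i j h
  unfold copyFrom at h
  split_ifs at h <;> simp_all

/-- The involution of the index set that exchanges innovation and copy after time `s`. -/
def exchangeAfter (s : ℤ) : ℤ ⊕ ℤ → ℤ ⊕ ℤ :=
  Sum.elim (fun i => if s < i then Sum.inr i else Sum.inl i)
    (fun i => if s < i then Sum.inl i else Sum.inr i)

theorem exchangeAfter_injective (s : ℤ) : (exchangeAfter s).Injective := by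
  rintro (i | i) (j | j) h <;> simp only [exchangeAfter, Sum.elim_inl, Sum.elim_inr] at h <;>
    split_ifs at h <;> simp only [Sum.inl.injEq, Sum.inr.injEq, reduceCtorEq] at h ⊢ <;> omega

/-- The mean square effect `E (Φ(ε) - Φ(ε with ε_s replaced by its copy))²`. -/
noncomputable def sqDep (P : Measure Ω) (ζ : ℤ ⊕ ℤ → Ω → E) (Φ : (ℤ → E) → ℝ) (s : ℤ) : ℝ :=
  ∫ ω, (Φ (fun k => ζ (Sum.inl k) ω) - Φ (fun k => ζ (copyAt s k) ω)) ^ 2 ∂P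

variable {ζ : ℤ ⊕ ℤ → Ω → E} {Φ Ψ : (ℤ → E) → ℝ}

theorem memLp_reindex (hm : ∀ i, Measurable (ζ i)) (hi : iIndepFun ζ P)
    (hd : ∀ i j, IdentDistrib (ζ i) (ζ j) P P) (hΨ : Measurable Ψ)
    (hΨ2 : MemLp (fun ω => Ψ fun k => ζ (Sum.inl k) ω) 2 P) {f : ℤ → ℤ ⊕ ℤ} (hf : f.Injective) :
    MemLp (fun ω => Ψ fun k => ζ (f k) ω) 2 P :=
  (((identDistrib_reindex hm hi hd Sum.inl_injective hf).comp hΨ).memLp_iff).1 hΨ2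

/-- Exchanging innovation and copy at all times after `s` preserves the law; it carries the original
sequence to the interpolant from `s + 1`, and the sequence with one copy at `s` to the interpolant
from `s`. -/
theorem integral_sq_copyFrom_sub (hm : ∀ i, Measurable (ζ i)) (hi : iIndepFun ζ P)
    (hd : ∀ i j, IdentDistrib (ζ i) (ζ j) P P) (hΨ : Measurable Ψ) (s : ℤ) :
    ∫ ω, (Ψ (fun k => ζ (copyFrom (s + 1) k) ω) - Ψ (fun k => ζ (copyFrom s k) ω)) ^ 2 ∂P
      = sqDep P ζ Ψ s := by
  have h := (identDistrib_reindex hm hi hd (exchangeAfter_injective s)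
    (Function.injective_id)).comp
    (u := fun z : ℤ ⊕ ℤ → E => (Ψ (fun k => z (Sum.inl k)) - Ψ (fun k => z (copyAt s k))) ^ 2)
    (by fun_prop)
  have h1 : ∀ k, exchangeAfter s (Sum.inl k) = copyFrom (s + 1) k := fun k => by
    simp [exchangeAfter, copyFrom]
  have h2 : ∀ k, exchangeAfter s (copyAt s k) = copyFrom s k := fun k => by
    unfold exchangeAfter copyFrom copyAt
    rcases lt_trichotomy k s with hk | hk | hk
    · simp [hk.ne, hk.not_ge, hk.not_gt]
    · simp [hk]
    · simp [hk.ne', hk.le, hk]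
  have h3 := h.integral_eq
  simpa only [sqDep, Function.comp_def, h1, h2, id] using h3

/-- The transposition of `ε_s` and its copy preserves the law and interchanges the two interpolants,
whence the sign. -/
theorem integral_mul_copyFrom_sub (hm : ∀ i, Measurable (ζ i)) (hi : iIndepFun ζ P)
    (hd : ∀ i j, IdentDistrib (ζ i) (ζ j) P P) (hΦ : Measurable Φ) (hΨ : Measurable Ψ) (s : ℤ) :
    ∫ ω, Φ (fun k => ζ (copyAt s k) ω) *
        (Ψ (fun k => ζ (copyFrom (s + 1) k) ω) - Ψ (fun k => ζ (copyFrom s k) ω)) ∂P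
      = - ∫ ω, Φ (fun k => ζ (Sum.inl k) ω) *
        (Ψ (fun k => ζ (copyFrom (s + 1) k) ω) - Ψ (fun k => ζ (copyFrom s k) ω)) ∂P := by
  have h := (identDistrib_reindex hm hi hd
    (Equiv.swap (Sum.inl s : ℤ ⊕ ℤ) (Sum.inr s)).injective (Function.injective_id)).comp
    (u := fun z : ℤ ⊕ ℤ → E => Φ (fun k => z (Sum.inl k)) *
      (Ψ (fun k => z (copyFrom (s + 1) k)) - Ψ (fun k => z (copyFrom s k)))) (by fun_prop)
  have h0 : ∀ k, Equiv.swap (Sum.inl s : ℤ ⊕ ℤ) (Sum.inr s) (Sum.inl k) = copyAt s k := fun k => by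
    by_cases hk : k = s
    · simp [hk, copyAt]
    · rw [Equiv.swap_apply_of_ne_of_ne (by simpa using hk) (by simp)]
      simp [hk, copyAt]
  have h1 : ∀ k, Equiv.swap (Sum.inl s : ℤ ⊕ ℤ) (Sum.inr s) (copyFrom (s + 1) k) = copyFrom s k := by
    intro k
    unfold copyFrom
    rcases lt_trichotomy k s with hk | hk | hk
    · rw [if_neg (by omega), if_neg (by omega),
        Equiv.swap_apply_of_ne_of_ne (by simpa using hk.ne) (by simp)]
    · simp [hk]
    · rw [if_pos (by omega), if_pos (by omega),
        Equiv.swap_apply_of_ne_of_ne (by simp) (by simpa using hk.ne')]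
  have h2 : ∀ k, Equiv.swap (Sum.inl s : ℤ ⊕ ℤ) (Sum.inr s) (copyFrom s k) = copyFrom (s + 1) k :=
    fun k => by rw [← h1, Equiv.swap_apply_self]
  have h3 := h.integral_eq
  simp only [Function.comp_def, h0, h1, h2, id] at h3
  rw [← h3, ← integral_neg]
  congr 1
  funext ω
  ring

/-- By antisymmetry `Φ` may be replaced by half of its change under the copy at `s`. Cauchy–Schwarz
then yields a product of two small factors; applied directly it would make only the factor of `Ψ`
small. -/
theorem abs_integral_mul_copyFrom_sub_le (hm : ∀ i, Measurable (ζ i)) (hi : iIndepFun ζ P)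
    (hd : ∀ i j, IdentDistrib (ζ i) (ζ j) P P) (hΦ : Measurable Φ) (hΨ : Measurable Ψ)
    (hΦ2 : MemLp (fun ω => Φ fun k => ζ (Sum.inl k) ω) 2 P)
    (hΨ2 : MemLp (fun ω => Ψ fun k => ζ (Sum.inl k) ω) 2 P) (s : ℤ) :
    |∫ ω, Φ (fun k => ζ (Sum.inl k) ω) *
        (Ψ (fun k => ζ (copyFrom (s + 1) k) ω) - Ψ (fun k => ζ (copyFrom s k) ω)) ∂P|
      ≤ 2⁻¹ * (√(sqDep P ζ Φ s) * √(sqDep P ζ Ψ s)) := by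
  have hΦs := memLp_reindex hm hi hd hΦ hΦ2 (copyAt_injective s)
  have hD := (memLp_reindex hm hi hd hΨ hΨ2 (copyFrom_injective (s + 1))).sub
    (memLp_reindex hm hi hd hΨ hΨ2 (copyFrom_injective s))
  have h1 := integral_mul_copyFrom_sub hm hi hd hΦ hΨ s
  have h2 := integral_sub (hΦ2.integrable_mul hD) (hΦs.integrable_mul hD)
  simp only [Pi.mul_apply, Pi.sub_apply, ← sub_mul] at h2
  rw [h1] at h2
  have h3 := abs_integral_mul_le_sqrt_mul_sqrt (hΦ2.sub hΦs) hD
  simp only [Pi.sub_apply] at h3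
  rw [integral_sq_copyFrom_sub hm hi hd hΨ s, h2, sub_neg_eq_add, ← two_mul, abs_mul,
    abs_two] at h3
  unfold sqDep at h3 ⊢
  linarith

/-- **Covariance bound.** The covariance of two square integrable functionals of an iid family is
controlled by the mean square effects of replacing single coordinates. -/
theorem abs_covariance_le_of_sum_sqDep_le [TopologicalSpace E] [PolishSpace E] [BorelSpace E]
    [IsProbabilityMeasure P] (hm : ∀ i, Measurable (ζ i)) (hi : iIndepFun ζ P)
    (hd : ∀ i j, IdentDistrib (ζ i) (ζ j) P P) (hΦ : Measurable Φ) (hΨ : Measurable Ψ)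
    (hΦ2 : MemLp (fun ω => Φ fun k => ζ (Sum.inl k) ω) 2 P)
    (hΨ2 : MemLp (fun ω => Ψ fun k => ζ (Sum.inl k) ω) 2 P) {B : ℝ}
    (hB : ∀ S : Finset ℤ, ∑ s ∈ S, √(sqDep P ζ Φ s) * √(sqDep P ζ Ψ s) ≤ B) :
    |covariance (fun ω => Φ fun k => ζ (Sum.inl k) ω) (fun ω => Ψ fun k => ζ (Sum.inl k) ω) P|
      ≤ 2⁻¹ * B := by
  set Z : Ω → ℝ := fun ω => Φ fun k => ζ (Sum.inl k) ω with hZ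
  -- As `s` runs from `-∞` to `∞`, `I s` runs from the product of the means to the mixed moment, so
  -- its total increment is the covariance.
  set I : ℤ → ℝ := fun s => ∫ ω, Z ω * Ψ (fun k => ζ (copyFrom s k) ω) ∂P with hI
  have hM := fun s => memLp_reindex hm hi hd hΨ hΨ2 (copyFrom_injective s)
  have hstep : ∀ s, |I (s + 1) - I s| ≤ 2⁻¹ * (√(sqDep P ζ Φ s) * √(sqDep P ζ Ψ s)) := by
    intro s
    have h2 := integral_sub (hΦ2.integrable_mul (hM (s + 1))) (hΦ2.integrable_mul (hM s))
    simp only [Pi.mul_apply, ← mul_sub] at h2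
    have h3 := abs_integral_mul_copyFrom_sub_le hm hi hd hΦ hΨ hΦ2 hΨ2 s
    rwa [h2] at h3
  have htel : ∀ (a : ℤ) (m : ℕ), |I (a + m) - I a| ≤ 2⁻¹ * B := by
    intro a m
    have h1 : I (a + m) - I a = ∑ i ∈ Finset.range m, (I (a + i + 1) - I (a + i)) := by
      have := Finset.sum_range_sub (fun i : ℕ => I (a + i)) m
      simp only [Nat.cast_zero, add_zero, Nat.cast_add, Nat.cast_one, ← add_assoc] at this
      exact this.symm
    rw [h1]
    refine (Finset.abs_sum_le_sum_abs _ _).trans ?_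
    refine (Finset.sum_le_sum (fun (i : ℕ) _ => hstep (a + i))).trans ?_
    rw [← Finset.mul_sum]
    refine mul_le_mul_of_nonneg_left ?_ (by norm_num)
    have := hB ((Finset.range m).map ⟨fun i : ℕ => a + (i : ℤ), fun i j h => by simpa using h⟩)
    rw [Finset.sum_map] at this
    exact this
  have hup : Tendsto (fun n : ℕ => I n) atTop (𝓝 (∫ ω, Z ω * Ψ (fun k => ζ (Sum.inl k) ω) ∂P)) := by
    refine tendsto_integral_mul_reindex hm hi hd (fun n => copyFrom_injective _)
      Sum.inl_injective ?_ hΨ hΨ2 hΦ2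
    intro k
    filter_upwards [eventually_gt_atTop k.toNat] with n hn
    simp only [copyFrom]
    rw [if_neg (by omega)]
  have hdown : Tendsto (fun n : ℕ => I (-n)) atTop
      (𝓝 (∫ ω, Z ω * Ψ (fun k => ζ (Sum.inr k) ω) ∂P)) := by
    refine tendsto_integral_mul_reindex hm hi hd (fun n => copyFrom_injective _)
      Sum.inr_injective ?_ hΨ (memLp_reindex hm hi hd hΨ hΨ2 Sum.inr_injective) hΦ2
    intro k
    filter_upwards [eventually_gt_atTop (-k).toNat] with n hn
    simp only [copyFrom]
    rw [if_pos (by omega)]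
  have hind : ∫ ω, Z ω * Ψ (fun k => ζ (Sum.inr k) ω) ∂P
      = (∫ ω, Z ω ∂P) * ∫ ω, Ψ (fun k => ζ (Sum.inl k) ω) ∂P := by
    have h1 : IndepFun Z (fun ω => Ψ fun k => ζ (Sum.inr k) ω) P :=
      (indepFun_reindex hm hi (f := (Sum.inl : ℤ → ℤ ⊕ ℤ)) (g := (Sum.inr : ℤ → ℤ ⊕ ℤ))
        (by simp)).comp hΦ hΨ
    have h2 := ((identDistrib_reindex hm hi hd (Sum.inl_injective (α := ℤ) (β := ℤ))
      Sum.inr_injective).comp hΨ).integral_eq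
    simp only [Function.comp_def] at h2
    rw [h2]
    exact h1.integral_mul_eq_mul_integral hΦ2.1
      (memLp_reindex hm hi hd hΨ hΨ2 Sum.inr_injective).1
  rw [covariance_eq_sub hΦ2 hΨ2]
  have hlim := (hup.sub hdown).abs
  rw [hind] at hlim
  refine le_of_tendsto hlim (Eventually.of_forall fun n => ?_)
  -- The `2 * n` steps from `-n` to `n` let both ends go to their limits along the same `n`.
  have := htel (-n) (2 * n)
  rwa [show (-(n : ℤ) + ((2 * n : ℕ) : ℤ)) = n by push_cast; ring] at this

end CovarianceBound

/-! ### Polynomial weights -/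

section Weight

theorem one_le_gu (r : ℤ) : 1 ≤ gu r := le_max_left _ _

theorem gu_pos (r : ℤ) : 0 < gu r := zero_lt_one.trans_le (one_le_gu r)

theorem abs_le_gu (r : ℤ) : |(r : ℝ)| ≤ gu r := le_max_right _ _

theorem gu_le_gu {r s : ℤ} (h : |r| ≤ |s|) : gu r ≤ gu s := by
  exact max_le_max_left _ (by exact_mod_cast h)

theorem summable_gu_rpow {κ : ℝ} (hκ : 1 < κ) : Summable fun r : ℤ => gu r ^ (-κ) := by
  -- The indicator of `0` pays for `gu 0 = 1`.
  have h1 := (Real.summable_abs_int_rpow hκ).add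
    (summable_of_hasFiniteSupport (f := fun r : ℤ => if r = 0 then (1 : ℝ) else 0)
      ((Set.finite_singleton 0).subset fun r => by simp))
  refine Summable.of_nonneg_of_le (fun r => Real.rpow_nonneg (gu_pos r).le _) (fun r => ?_) h1
  by_cases hr : r = 0
  · subst hr
    simp [gu, Real.rpow_nonneg]
  · have : (1 : ℝ) ≤ |(r : ℝ)| := by exact_mod_cast Int.one_le_abs hr
    simp [gu, hr, this]

/-- For lags of the same sign the larger is at least `|m - n|`: its weight is traded for that of the
difference and the other is kept. No factor `2 ^ κ` is lost. -/
theorem gu_rpow_mul_gu_rpow_le {κ : ℝ} (hκ : 0 ≤ κ) {m n : ℤ} (hm : 0 ≤ m) (hn : 0 ≤ n) :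
    gu m ^ (-κ) * gu n ^ (-κ) ≤ gu (m - n) ^ (-κ) * (gu m ^ (-κ) + gu n ^ (-κ)) := by
  have hm0 := Real.rpow_nonneg (gu_pos m).le (-κ)
  have hn0 := Real.rpow_nonneg (gu_pos n).le (-κ)
  have hd0 := Real.rpow_nonneg (gu_pos (m - n)).le (-κ)
  have key : ∀ {k : ℤ}, |m - n| ≤ |k| → gu k ^ (-κ) ≤ gu (m - n) ^ (-κ) := fun h =>
    Real.rpow_le_rpow_of_nonpos (gu_pos _) (gu_le_gu h) (by linarith)
  rcases le_total m n with h | h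
  · have := key (k := n) (abs_le_abs (by omega) (by omega))
    nlinarith
  · have := key (k := m) (abs_le_abs (by omega) (by omega))
    nlinarith

end Weight

/-! ### The spectral norm through bilinear forms -/

section SpectralNorm

variable {p : ℕ}

theorem specNorm_nonneg (A : Mat p) : 0 ≤ specNorm A := norm_nonneg _

theorem specNorm_add_le (A B : Mat p) : specNorm (A + B) ≤ specNorm A + specNorm B := by
  unfold specNorm
  rw [map_add]
  exact norm_add_le _ _

theorem specNorm_sub_le (A B : Mat p) : specNorm (A - B) ≤ specNorm A + specNorm B := by
  unfold specNorm
  rw [map_sub]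
  exact norm_sub_le _ _

theorem specNorm_smul (c : ℝ) (A : Mat p) : specNorm (c • A) = |c| * specNorm A := by
  unfold specNorm
  rw [map_smul, norm_smul, Real.norm_eq_abs]

theorem abs_inner_toEuclideanCLM_le (A : Mat p) (a b : Vec p) :
    |inner ℝ a (Matrix.toEuclideanCLM (n := Fin p) (𝕜 := ℝ) A b)| ≤ specNorm A * (‖a‖ * ‖b‖) := by
  refine (abs_real_inner_le_norm _ _).trans ?_
  have := (Matrix.toEuclideanCLM (n := Fin p) (𝕜 := ℝ) A).le_opNorm b
  unfold specNorm
  nlinarith [norm_nonneg a]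

theorem specNorm_le_of_abs_inner_le {A : Mat p} {c : ℝ} (hc : 0 ≤ c)
    (h : ∀ a b : Vec p,
      |inner ℝ a (Matrix.toEuclideanCLM (n := Fin p) (𝕜 := ℝ) A b)| ≤ c * (‖a‖ * ‖b‖)) :
    specNorm A ≤ c := by
  refine ContinuousLinearMap.opNorm_le_bound _ hc fun b => ?_
  set y := Matrix.toEuclideanCLM (n := Fin p) (𝕜 := ℝ) A b with hy
  -- The test vector is `A b` itself; one factor `‖A b‖` cancels unless it is zero.
  have h1 := h y b
  rw [← hy, real_inner_self_eq_norm_sq, abs_of_nonneg (by positivity)] at h1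
  rcases (norm_nonneg y).eq_or_lt with h0 | h0
  · rw [← h0]; positivity
  · nlinarith

theorem inner_toEuclideanCLM (A : Mat p) (a b : Vec p) :
    inner ℝ a (Matrix.toEuclideanCLM (n := Fin p) (𝕜 := ℝ) A b) = ∑ i, ∑ j, a i * b j * A i j := by
  simp only [PiLp.inner_apply, Matrix.ofLp_toEuclideanCLM, Matrix.mulVec, dotProduct, RCLike.inner_apply,
    conj_trivial, Finset.sum_mul]
  exact Finset.sum_congr rfl fun i _ => Finset.sum_congr rfl fun j _ => by ring

end SpectralNorm

/-! ### Covariance matrices -/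

section CovarianceMatrix

variable {p : ℕ} {Ω : Type*} [MeasurableSpace Ω] {P : Measure Ω}

theorem memLp_coord {U : Ω → Vec p} (hU : MemLp U 2 P) (i : Fin p) : MemLp (fun ω => U ω i) 2 P :=
  hU.continuousLinearMap_comp (EuclideanSpace.proj (𝕜 := ℝ) i)

theorem memLp_inner {U : Ω → Vec p} (hU : MemLp U 2 P) (a : Vec p) :
    MemLp (fun ω => inner ℝ a (U ω)) 2 P :=
  hU.continuousLinearMap_comp (innerSL ℝ a)

theorem covMat_transpose (U V : Ω → Vec p) : (covMat P U V).transpose = covMat P V U := by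
  ext i j
  exact covariance_comm _ _

variable [IsProbabilityMeasure P]

/-- This reduces spectral norm bounds to covariances of scalar projections, to which the
interpolation argument applies. -/
theorem covariance_inner_inner {U V : Ω → Vec p} (hU : MemLp U 2 P) (hV : MemLp V 2 P)
    (a b : Vec p) :
    covariance (fun ω => inner ℝ a (U ω)) (fun ω => inner ℝ b (V ω)) P
      = inner ℝ a (Matrix.toEuclideanCLM (n := Fin p) (𝕜 := ℝ) (covMat P U V) b) := by
  rw [inner_toEuclideanCLM]
  simp only [PiLp.inner_apply, RCLike.inner_apply, conj_trivial]
  rw [covariance_fun_sum_fun_sum (fun i => (memLp_coord hU i).mul_const _)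
    (fun i => (memLp_coord hV i).mul_const _)]
  refine Finset.sum_congr rfl fun i _ => Finset.sum_congr rfl fun j _ => ?_
  rw [covariance_mul_const_left, covariance_mul_const_right]
  simp only [covMat, Matrix.of_apply]
  ring

theorem covMat_sub_left {U U' V : Ω → Vec p} (hU : MemLp U 2 P) (hU' : MemLp U' 2 P)
    (hV : MemLp V 2 P) : covMat P (fun ω => U ω - U' ω) V = covMat P U V - covMat P U' V := by
  ext i j
  exact covariance_sub_left (memLp_coord hU i) (memLp_coord hU' i) (memLp_coord hV j)

theorem covMat_sub_right {U V V' : Ω → Vec p} (hU : MemLp U 2 P) (hV : MemLp V 2 P)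
    (hV' : MemLp V' 2 P) : covMat P U (fun ω => V ω - V' ω) = covMat P U V - covMat P U V' := by
  ext i j
  exact covariance_sub_right (memLp_coord hU i) (memLp_coord hV j) (memLp_coord hV' j)

end CovarianceMatrix

/-! ### Covariance decay for causal processes -/

section CausalProcess

variable {p : ℕ} {Ω : Type*} {ε ε' : ℤ → Ω → Vec p}

theorem coupledPast_eq (t : ℤ) (j : ℕ) (ω : Ω) :
    coupledPast ε ε' t j ω = fun i : ℕ => Sum.elim ε ε' (copyAt (t - j) (t - i)) ω := by
  funext i
  by_cases h : i = j
  · simp [coupledPast, copyAt, h]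
  · simp [coupledPast, copyAt, h]

variable [MeasurableSpace Ω] {P : Measure Ω}

theorem IIDWithCopy.measurable_elim (hε : IIDWithCopy P ε ε') (i : ℤ ⊕ ℤ) :
    Measurable (Sum.elim ε ε' i) := by
  rcases i with i | i
  exacts [hε.measurable i, hε.measurable_copy i]

theorem IIDWithCopy.identDistrib_elim (hε : IIDWithCopy P ε ε') (i j : ℤ ⊕ ℤ) :
    IdentDistrib (Sum.elim ε ε' i) (Sum.elim ε ε' j) P P := by
  have h : ∀ i, IdentDistrib (Sum.elim ε ε' i) (ε 0) P P := by
    rintro (i | i)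
    exacts [hε.ident i, hε.ident_copy i]
  exact (h i).trans (h j).symm

/-- The real functional `⟨a, g(e_t, e_{t-1}, …)⟩` of a two-sided sequence `e`. -/
noncomputable def causalFunctional (g : (ℕ → Vec p) → Vec p) (t : ℤ) (a : Vec p) (e : ℤ → Vec p) :
    ℝ :=
  inner ℝ a (g fun i => e (t - i))

theorem measurable_causalFunctional {g : (ℕ → Vec p) → Vec p} (hg : Measurable g) (t : ℤ)
    (a : Vec p) : Measurable (causalFunctional g t a) := by
  have : Measurable fun e : ℤ → Vec p => g fun i => e (t - i) :=
    hg.comp (measurable_pi_iff.2 fun i => measurable_pi_apply _)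
  exact (innerSL ℝ a).continuous.measurable.comp this

/-- Causality: later innovations are invisible at time `t`. -/
theorem sqDep_causalFunctional_of_lt (g : (ℕ → Vec p) → Vec p) {t s : ℤ} (h : t < s) (a : Vec p) :
    sqDep P (Sum.elim ε ε') (causalFunctional g t a) s = 0 := by
  have : ∀ i : ℕ, copyAt s (t - i) = Sum.inl (t - i) := fun i => by
    rw [copyAt, if_neg (by omega)]
  simp [sqDep, causalFunctional, this]

theorem identDistrib_past_coupledPast (hε : IIDWithCopy P ε ε') (t : ℤ) (j : ℕ) :
    IdentDistrib (past ε t) (coupledPast ε ε' t j) P P := by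
  have := identDistrib_reindex hε.measurable_elim hε.indep hε.identDistrib_elim
    (f := fun i : ℕ => Sum.inl (t - i)) (g := fun i : ℕ => copyAt (t - j) (t - i))
    (fun a b h => by simpa using h)
    (fun a b h => by simpa using copyAt_injective _ h)
  rwa [← funext (coupledPast_eq t j)] at this

/-- Covariances of a causal stationary process depend on the time lag only. -/
theorem covMat_past_shift (hε : IIDWithCopy P ε ε') {g h : (ℕ → Vec p) → Vec p}
    (hg : Measurable g) (hh : Measurable h) (t τ s : ℤ) :
    covMat P (fun ω => g (past ε (t + s) ω)) (fun ω => h (past ε (τ + s) ω))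
      = covMat P (fun ω => g (past ε t ω)) (fun ω => h (past ε τ ω)) := by
  have hid := identDistrib_reindex hε.measurable_elim hε.indep hε.identDistrib_elim
    (f := fun i : ℤ => Sum.inl (i + s)) (g := fun i : ℤ => Sum.inl i)
    (fun a b h => by simpa using h) (fun a b h => by simpa using h)
  have hmeas : ∀ {f : (ℕ → Vec p) → Vec p}, Measurable f → ∀ (t : ℤ) (i : Fin p),
      Measurable fun e : ℤ → Vec p => f (fun k => e (t - k)) i := fun {f} hf t i =>
    (EuclideanSpace.proj (𝕜 := ℝ) i).continuous.measurable.comp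
      (hf.comp (measurable_pi_iff.2 fun k => measurable_pi_apply _))
  have hpast : ∀ t ω, past ε (t + s) ω = fun k : ℕ => Sum.elim ε ε' (Sum.inl (t - k + s)) ω := by
    intro t ω
    funext k
    simp only [past, Sum.elim_inl]
    congr 1
    ring
  ext i j
  have h1 := (hid.comp (hmeas hg t i)).integral_eq
  have h2 := (hid.comp (hmeas hh τ j)).integral_eq
  simp only [covMat, Matrix.of_apply, covariance, hpast]
  simp only [Function.comp_def] at h1 h2
  rw [h1, h2]
  have h3 := (hid.comp (u := fun e : ℤ → Vec p =>
    (g (fun k => e (t - k)) i - ∫ ω, g (fun k => Sum.elim ε ε' (Sum.inl (t - k)) ω) i ∂P) *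
    (h (fun k => e (τ - k)) j - ∫ ω, h (fun k => Sum.elim ε ε' (Sum.inl (τ - k)) ω) j ∂P))
    (((hmeas hg t i).sub_const _).mul ((hmeas hh τ j).sub_const _))).integral_eq
  exact h3

variable [IsProbabilityMeasure P]

/-- The coupled history has the law of the original one, so the difference has mean zero, and its
second moment in direction `a` is the quadratic form of its variance matrix. -/
theorem sqDep_causalFunctional_le (hε : IIDWithCopy P ε ε') {g : (ℕ → Vec p) → Vec p}
    (hg : Measurable g) {t : ℤ} (hg2 : MemLp (fun ω => g (past ε t ω)) 2 P) (a : Vec p) (j : ℕ) :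
    √(sqDep P (Sum.elim ε ε') (causalFunctional g t a) (t - j)) ≤ ‖a‖ * physDep P ε ε' g t j := by
  have hid := (identDistrib_past_coupledPast hε t j).comp hg
  have hg2' : MemLp (fun ω => g (coupledPast ε ε' t j ω)) 2 P := hid.memLp_iff.1 hg2
  have hD : MemLp (fun ω => g (past ε t ω) - g (coupledPast ε ε' t j ω)) 2 P := hg2.sub hg2'
  have hmean : ∫ ω, (inner ℝ a (g (past ε t ω) - g (coupledPast ε ε' t j ω)) : ℝ) ∂P = 0 := by
    rw [integral_inner (hD.integrable (by norm_num)),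
      integral_sub (hg2.integrable (by norm_num)) (hg2'.integrable (by norm_num))]
    have h2 := hid.integral_eq
    simp only [Function.comp_def] at h2
    rw [h2, sub_self, inner_zero_right]
  have hvar : sqDep P (Sum.elim ε ε') (causalFunctional g t a) (t - j)
      = inner ℝ a (Matrix.toEuclideanCLM (n := Fin p) (𝕜 := ℝ)
          (varMat P fun ω => g (past ε t ω) - g (coupledPast ε ε' t j ω)) a) := by
    rw [varMat, ← covariance_inner_inner hD hD, covariance, hmean]
    unfold sqDep
    refine integral_congr_ae (Eventually.of_forall fun ω => ?_)
    simp only [causalFunctional, sub_zero, coupledPast_eq, inner_sub_right, sq]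
    rfl
  rw [hvar, physDep]
  refine Real.sqrt_le_iff.2 ⟨by positivity, ?_⟩
  rw [mul_pow, Real.sq_sqrt (specNorm_nonneg _)]
  have := (le_abs_self _).trans (abs_inner_toEuclideanCLM_le
    (varMat P fun ω => g (past ε t ω) - g (coupledPast ε ε' t j ω)) a a)
  nlinarith

/-- Physical dependence of order `⟨j⟩^{-κ}` gives covariances of order `⟨t-τ⟩^{-κ}`. -/
theorem specNorm_covMat_le (hε : IIDWithCopy P ε ε') {g h : (ℕ → Vec p) → Vec p}
    (hg : Measurable g) (hh : Measurable h) {t τ : ℤ}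
    (hg2 : MemLp (fun ω => g (past ε t ω)) 2 P) (hh2 : MemLp (fun ω => h (past ε τ ω)) 2 P)
    {κ K₁ K₂ : ℝ} (hκ : 1 < κ) (hgd : ∀ j : ℕ, physDep P ε ε' g t j ≤ K₁ * gu j ^ (-κ))
    (hhd : ∀ j : ℕ, physDep P ε ε' h τ j ≤ K₂ * gu j ^ (-κ)) :
    specNorm (covMat P (fun ω => g (past ε t ω)) (fun ω => h (past ε τ ω)))
      ≤ K₁ * K₂ * (∑' r : ℤ, gu r ^ (-κ)) * gu (t - τ) ^ (-κ) := by
  -- Lag `0` has weight `1`, so a bound there forces the constant to be nonnegative.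
  have hpos : ∀ {f : (ℕ → Vec p) → Vec p} {s : ℤ} {K : ℝ},
      (∀ j : ℕ, physDep P ε ε' f s j ≤ K * gu j ^ (-κ)) → 0 ≤ K := fun {f s K} hf => by
    have := (Real.sqrt_nonneg _).trans (hf 0)
    simpa [gu] using this
  have hK₁ := hpos hgd
  have hK₂ := hpos hhd
  set S := ∑' r : ℤ, gu r ^ (-κ) with hS
  have hsum := summable_gu_rpow hκ
  have hg0 : ∀ r : ℤ, 0 ≤ gu r ^ (-κ) := fun r => Real.rpow_nonneg (gu_pos r).le _
  have hS0 : 0 ≤ S := tsum_nonneg hg0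
  have hshift : ∀ t : ℤ, HasSum (fun s : ℤ => gu (t - s) ^ (-κ)) S := fun t =>
    (Equiv.subLeft t).hasSum_iff.2 hsum.hasSum
  have hgtτ := hg0 (t - τ)
  refine specNorm_le_of_abs_inner_le (by positivity) fun a b => ?_
  rw [← covariance_inner_inner hg2 hh2]
  have key : ∀ {f : (ℕ → Vec p) → Vec p} {s t : ℤ} {K : ℝ} {a : Vec p}, Measurable f →
      MemLp (fun ω => f (past ε t ω)) 2 P → s ≤ t →
      (∀ j : ℕ, physDep P ε ε' f t j ≤ K * gu j ^ (-κ)) →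
      √(sqDep P (Sum.elim ε ε') (causalFunctional f t a) s) ≤ ‖a‖ * K * gu (t - s) ^ (-κ) := by
    intro f s t K a hf hf2 hst hfd
    obtain ⟨j, rfl⟩ : ∃ j : ℕ, s = t - j := ⟨(t - s).toNat, by omega⟩
    refine (sqDep_causalFunctional_le hε hf hf2 a j).trans ?_
    rw [sub_sub_cancel, mul_assoc]
    exact mul_le_mul_of_nonneg_left (hfd j) (norm_nonneg _)
  have hterm : ∀ s : ℤ, √(sqDep P (Sum.elim ε ε') (causalFunctional g t a) s) *
      √(sqDep P (Sum.elim ε ε') (causalFunctional h τ b) s) ≤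
      ‖a‖ * ‖b‖ * (K₁ * K₂) * gu (t - τ) ^ (-κ) * (gu (t - s) ^ (-κ) + gu (τ - s) ^ (-κ)) := by
    intro s
    have hr : 0 ≤ ‖a‖ * ‖b‖ * (K₁ * K₂) * gu (t - τ) ^ (-κ) *
        (gu (t - s) ^ (-κ) + gu (τ - s) ^ (-κ)) := by
      have := hg0 (t - τ); have := hg0 (t - s); have := hg0 (τ - s)
      positivity
    rcases lt_or_ge t s with hs | hs
    · rw [sqDep_causalFunctional_of_lt g hs]
      simpa using hr
    rcases lt_or_ge τ s with hs' | hs'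
    · rw [sqDep_causalFunctional_of_lt h hs']
      simpa using hr
    calc _ ≤ (‖a‖ * K₁ * gu (t - s) ^ (-κ)) * (‖b‖ * K₂ * gu (τ - s) ^ (-κ)) := by
          have := hg0 (t - s)
          exact mul_le_mul (key hg hg2 hs hgd) (key hh hh2 hs' hhd) (Real.sqrt_nonneg _)
            (by positivity)
      _ = (‖a‖ * ‖b‖ * (K₁ * K₂)) * (gu (t - s) ^ (-κ) * gu (τ - s) ^ (-κ)) := by ring
      _ ≤ (‖a‖ * ‖b‖ * (K₁ * K₂)) *
          (gu (t - τ) ^ (-κ) * (gu (t - s) ^ (-κ) + gu (τ - s) ^ (-κ))) := by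
          have := gu_rpow_mul_gu_rpow_le (κ := κ) (by linarith) (sub_nonneg.2 hs) (sub_nonneg.2 hs')
          rw [sub_sub_sub_cancel_right] at this
          gcongr
      _ = _ := by ring
  -- Each of the two weights left in `hterm` sums to at most `S`; the resulting factor `2` cancels
  -- the `2⁻¹` of the covariance bound.
  have hmain := abs_covariance_le_of_sum_sqDep_le hε.measurable_elim hε.indep hε.identDistrib_elim
    (measurable_causalFunctional hg t a) (measurable_causalFunctional hh τ b)
    (memLp_inner hg2 a) (memLp_inner hh2 b)
    (B := ‖a‖ * ‖b‖ * (K₁ * K₂) * gu (t - τ) ^ (-κ) * (S + S)) (by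
      intro F
      refine (Finset.sum_le_sum fun s _ => hterm s).trans ?_
      rw [← Finset.mul_sum]
      have := hg0 (t - τ)
      refine mul_le_mul_of_nonneg_left ?_ (by positivity)
      exact sum_le_hasSum F (fun s _ => add_nonneg (hg0 _) (hg0 _)) ((hshift t).add (hshift τ)))
  refine hmain.trans_eq ?_
  ring

end CausalProcess

/-! ### Decay and smoothness of the covariances -/

section LocallyStationary

/-- Physical dependence of order `⟨j⟩^{-κ}` of the array, of its stationary approximations and of
their differences gives covariance decay and smoothness of the covariances. -/
theorem covarianceDecay_and_smoothness {p : ℕ} {Ω : Type*} [MeasurableSpace Ω] {P : Measure Ω}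
    [IsProbabilityMeasure P] {ε ε' : ℤ → Ω → Vec p} (hε : IIDWithCopy P ε ε')
    {GN : ℕ → ℤ → (ℕ → Vec p) → Vec p} {G : ℝ → (ℕ → Vec p) → Vec p}
    (hGN : ∀ N : ℕ, 1 ≤ N → ∀ t : ℤ, Measurable (GN N t)) (hG : ∀ u : ℝ, Measurable (G u))
    (hX2 : ∀ N : ℕ, 1 ≤ N → ∀ t : ℤ, MemLp (fun ω => GN N t (past ε t ω)) 2 P)
    (hY2 : ∀ (u : ℝ) (t : ℤ), MemLp (fun ω => G u (past ε t ω)) 2 P)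
    {K κ : ℝ} (hκ : 1 < κ)
    (hA₁ : ∀ N : ℕ, 1 ≤ N → ∀ (t : ℤ) (j : ℕ),
      physDep P ε ε' (GN N t) t j ≤ K * gu j ^ (-κ))
    (hA₂ : ∀ (u : ℝ) (t : ℤ) (j : ℕ), physDep P ε ε' (G u) t j ≤ K * gu j ^ (-κ))
    (hA₃ : ∀ (v₁ v₂ : ℝ) (t : ℤ) (j : ℕ),
      physDep P ε ε' (fun F => G v₁ F - G v₂ F) t j ≤ K * |v₁ - v₂| * gu j ^ (-κ))
    (hA₄ : ∀ N : ℕ, 1 ≤ N → ∀ (t : ℤ) (j : ℕ),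
      physDep P ε ε' (fun F => GN N t F - G ((t : ℝ) / (N : ℝ)) F) t j
        ≤ K * (N : ℝ)⁻¹ * gu j ^ (-κ)) :
    ∃ K' : ℝ, 0 < K' ∧
      CovarianceDecay (fun N t τ => covMat P (fun ω => GN N t (past ε t ω))
        (fun ω => GN N τ (past ε τ ω))) K' κ ∧
      SmoothnessCondition (fun N t τ => covMat P (fun ω => GN N t (past ε t ω))
        (fun ω => GN N τ (past ε τ ω)))
        (fun r u => covMat P (fun ω => G u (past ε r ω)) (fun ω => G u (past ε 0 ω))) K' κ := by
  have hK : 0 ≤ K := by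
    have := (Real.sqrt_nonneg _).trans (hA₂ 0 0 0)
    simpa [gu] using this
  set S := ∑' r : ℤ, gu r ^ (-κ) with hS
  have hg0 : ∀ r : ℤ, 0 ≤ gu r ^ (-κ) := fun r => Real.rpow_nonneg (gu_pos r).le _
  have hS0 : 0 ≤ S := tsum_nonneg hg0
  have hdiv : ∀ (c : ℝ) (r : ℤ), c / gu r ^ κ = c * gu r ^ (-κ) := fun c r => by
    rw [Real.rpow_neg (gu_pos r).le, div_eq_mul_inv]
  have hA0 : 0 ≤ K * K * S := by positivity
  have hXX : ∀ N : ℕ, 1 ≤ N → ∀ t τ : ℤ, specNorm (covMat P (fun ω => GN N t (past ε t ω))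
      (fun ω => GN N τ (past ε τ ω))) ≤ K * K * S * gu (t - τ) ^ (-κ) := fun N hN t τ =>
    specNorm_covMat_le hε (hGN N hN t) (hGN N hN τ) (hX2 N hN t) (hX2 N hN τ) hκ (hA₁ N hN t)
      (hA₁ N hN τ)
  have hYY : ∀ (u : ℝ) (t τ : ℤ), specNorm (covMat P (fun ω => G u (past ε t ω))
      (fun ω => G u (past ε τ ω))) ≤ K * K * S * gu (t - τ) ^ (-κ) := fun u t τ =>
    specNorm_covMat_le hε (hG u) (hG u) (hY2 u t) (hY2 u τ) hκ (hA₂ u t) (hA₂ u τ)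
  have hstat : ∀ (u : ℝ) (t τ : ℤ),
      covMat P (fun ω => G u (past ε (t - τ) ω)) (fun ω => G u (past ε 0 ω))
        = covMat P (fun ω => G u (past ε t ω)) (fun ω => G u (past ε τ ω)) := fun u t τ => by
    have := covMat_past_shift hε (hG u) (hG u) (t - τ) 0 τ
    rw [sub_add_cancel, zero_add] at this
    exact this.symm
  -- The `3` counts the terms in the comparison with the stationary covariance; the `1` secures
  -- positivity.
  refine ⟨3 * (K * K * S) + 1, by positivity, ?_, ?_, ?_, ?_, ?_⟩
  · intro N hN t τ
    rw [hdiv]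
    refine (hXX N hN t τ).trans (mul_le_mul_of_nonneg_right (by linarith) (hg0 _))
  · intro r u
    have := hstat u 0 r
    rw [zero_sub] at this
    rw [this, covMat_transpose]
  · intro r u
    rw [hdiv]
    have := hYY u r 0
    rw [sub_zero] at this
    exact this.trans (mul_le_mul_of_nonneg_right (by linarith) (hg0 _))
  · intro r u v
    have hD : ∀ t, MemLp (fun ω => G u (past ε t ω) - G v (past ε t ω)) 2 P := fun t =>
      (hY2 u t).sub (hY2 v t)
    have e : covMat P (fun ω => G u (past ε r ω)) (fun ω => G u (past ε 0 ω))
          - covMat P (fun ω => G v (past ε r ω)) (fun ω => G v (past ε 0 ω))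
        = covMat P (fun ω => G u (past ε r ω) - G v (past ε r ω)) (fun ω => G u (past ε 0 ω))
          + covMat P (fun ω => G v (past ε r ω))
            (fun ω => G u (past ε 0 ω) - G v (past ε 0 ω)) := by
      rw [covMat_sub_left (hY2 u r) (hY2 v r) (hY2 u 0),
        covMat_sub_right (hY2 v r) (hY2 u 0) (hY2 v 0)]
      abel
    have h1 := specNorm_covMat_le hε ((hG u).sub (hG v)) (hG u) (hD r) (hY2 u 0) hκ (hA₃ u v r)
      (hA₂ u 0)
    have h2 := specNorm_covMat_le hε (hG v) ((hG u).sub (hG v)) (hY2 v r) (hD 0) hκ (hA₂ v r)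
      (hA₃ u v 0)
    simp only [Pi.sub_apply, sub_zero] at h1 h2
    rw [hdiv, e]
    refine (specNorm_add_le _ _).trans ((add_le_add h1 h2).trans ?_)
    have := mul_nonneg (abs_nonneg (u - v)) (hg0 r)
    rw [← hS]
    nlinarith
  · intro N hN t τ
    have hN0 : (0 : ℝ) < N := by exact_mod_cast hN
    set u := (t : ℝ) / N with hu
    set w := (τ : ℝ) / N with hw
    have hX := hX2 N hN
    have hgu := gu_pos (t - τ)
    have hgκ : gu (t - τ) ^ (κ - 1) = gu (t - τ) ^ κ / gu (t - τ) := Real.rpow_sub_one hgu.ne' κ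
    have hpow : 0 < gu (t - τ) ^ κ := Real.rpow_pos_of_pos hgu κ
    -- With the weight of order `-κ` factored out, the minimum is between `gu (t - τ) / N` and `2`.
    have hrhs : ∀ x y : ℝ, x / gu (t - τ) ^ (κ - 1) * y
        = x * (gu (t - τ) * y) * gu (t - τ) ^ (-κ) := fun x y => by
      rw [hgκ, Real.rpow_neg hgu.le]
      field_simp
    rw [hstat, hrhs]
    have hcoarse : specNorm (covMat P (fun ω => GN N t (past ε t ω)) (fun ω => GN N τ (past ε τ ω))
        - covMat P (fun ω => G u (past ε t ω)) (fun ω => G u (past ε τ ω)))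
        ≤ (K * K * S) * 2 * gu (t - τ) ^ (-κ) :=
      (specNorm_sub_le _ _).trans ((add_le_add (hXX N hN t τ) (hYY u t τ)).trans_eq (by ring))
    -- Each time is first compared with the stationary process at its own rescaled time, at cost
    -- `1/N`; then `w = τ/N` is moved to `u = t/N`, at cost `|t - τ|/N`. This last move loses one
    -- power of the weight.
    have e : covMat P (fun ω => GN N t (past ε t ω)) (fun ω => GN N τ (past ε τ ω))
          - covMat P (fun ω => G u (past ε t ω)) (fun ω => G u (past ε τ ω))
        = covMat P (fun ω => GN N t (past ε t ω) - G u (past ε t ω))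
            (fun ω => GN N τ (past ε τ ω))
          + covMat P (fun ω => G u (past ε t ω))
            (fun ω => GN N τ (past ε τ ω) - G w (past ε τ ω))
          + covMat P (fun ω => G u (past ε t ω))
            (fun ω => G w (past ε τ ω) - G u (past ε τ ω)) := by
      rw [covMat_sub_left (hX t) (hY2 u t) (hX τ), covMat_sub_right (hY2 u t) (hX τ) (hY2 w τ),
        covMat_sub_right (hY2 u t) (hY2 w τ) (hY2 u τ)]
      abel
    have h1 := specNorm_covMat_le hε ((hGN N hN t).sub (hG u)) (hGN N hN τ)
      ((hX t).sub (hY2 u t)) (hX τ) hκ (hA₄ N hN t) (hA₁ N hN τ)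
    have h2 := specNorm_covMat_le hε (hG u) ((hGN N hN τ).sub (hG w)) (hY2 u t)
      ((hX τ).sub (hY2 w τ)) hκ (hA₂ u t) (hA₄ N hN τ)
    have h3 := specNorm_covMat_le hε (hG u) ((hG w).sub (hG u)) (hY2 u t)
      ((hY2 w τ).sub (hY2 u τ)) hκ (hA₂ u t) (hA₃ w u τ)
    simp only [Pi.sub_apply] at h1 h2 h3
    rw [← hS] at h1 h2 h3
    have hwu : |w - u| ≤ gu (t - τ) * (1 / N) := by
      have h4 : w - u = -(((t - τ : ℤ) : ℝ)) / N := by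
        rw [hu, hw]; push_cast; ring
      rw [h4, abs_div, abs_neg, abs_of_pos hN0, div_eq_mul_one_div]
      exact mul_le_mul_of_nonneg_right (abs_le_gu _) (by positivity)
    have hinv : (N : ℝ)⁻¹ ≤ gu (t - τ) * (1 / N) := by
      rw [one_div]
      exact le_mul_of_one_le_left (by positivity) (one_le_gu _)
    have hfine : specNorm (covMat P (fun ω => GN N t (past ε t ω)) (fun ω => GN N τ (past ε τ ω))
        - covMat P (fun ω => G u (past ε t ω)) (fun ω => G u (past ε τ ω)))
        ≤ 3 * (K * K * S) * (gu (t - τ) * (1 / N)) * gu (t - τ) ^ (-κ) := by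
      rw [e]
      refine (specNorm_add_le _ _).trans ((add_le_add (specNorm_add_le _ _) le_rfl).trans ?_)
      refine (add_le_add (add_le_add h1 h2) h3).trans ?_
      calc _ = (K * K * S) * ((N : ℝ)⁻¹ + (N : ℝ)⁻¹ + |w - u|) * gu (t - τ) ^ (-κ) := by ring
        _ ≤ (K * K * S) * (gu (t - τ) * (1 / N) + gu (t - τ) * (1 / N) + gu (t - τ) * (1 / N))
            * gu (t - τ) ^ (-κ) := by
          refine mul_le_mul_of_nonneg_right (mul_le_mul_of_nonneg_left ?_ hA0) (hg0 _)
          linarith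
        _ = _ := by ring
    rcases min_choice (1 / (N : ℝ)) (2 / gu (t - τ)) with h | h <;> rw [h]
    · refine hfine.trans (mul_le_mul_of_nonneg_right (mul_le_mul_of_nonneg_right (by linarith) ?_)
        (hg0 _))
      positivity
    · rw [mul_div_cancel₀ _ hgu.ne']
      exact hcoarse.trans (mul_le_mul_of_nonneg_right (by linarith) (hg0 _))

end LocallyStationary

/-! ### Block Toeplitz forms and their symbols -/

theorem Finset.sum_sum_comm_sum_sum {α β γ δ M : Type*} [AddCommMonoid M] (A : Finset α)
    (B : Finset β) (C : Finset γ) (D : Finset δ) (f : α → β → γ → δ → M) :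
    ∑ a ∈ A, ∑ b ∈ B, ∑ c ∈ C, ∑ d ∈ D, f a b c d
      = ∑ c ∈ C, ∑ d ∈ D, ∑ a ∈ A, ∑ b ∈ B, f a b c d :=
  calc _ = ∑ a ∈ A, ∑ c ∈ C, ∑ b ∈ B, ∑ d ∈ D, f a b c d :=
        Finset.sum_congr rfl fun _ _ => Finset.sum_comm
    _ = ∑ c ∈ C, ∑ a ∈ A, ∑ b ∈ B, ∑ d ∈ D, f a b c d := Finset.sum_comm
    _ = ∑ c ∈ C, ∑ a ∈ A, ∑ d ∈ D, ∑ b ∈ B, f a b c d :=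
        Finset.sum_congr rfl fun _ _ => Finset.sum_congr rfl fun _ _ => Finset.sum_comm
    _ = _ := Finset.sum_congr rfl fun _ _ => Finset.sum_comm

section Toeplitz

variable {p : ℕ}

theorem abs_entry_le_specNorm (A : Mat p) (i j : Fin p) : |A i j| ≤ specNorm A := by
  have h := abs_inner_toEuclideanCLM_le A (EuclideanSpace.single i 1) (EuclideanSpace.single j 1)
  rw [inner_toEuclideanCLM, Finset.sum_eq_single i, Finset.sum_eq_single j] at h
  · simpa using h
  · intro k _ hk
    simp [hk]
  · simp
  · intro k _ hk
    simp [hk]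
  · simp

theorem hasSum_spectralDensity_entry {C : ℤ → Mat p} (hC : Summable fun r => specNorm (C r))
    (ω : ℝ) (i j : Fin p) :
    HasSum (fun r : ℤ => Complex.exp (Complex.I * (r : ℂ) * (ω : ℂ)) * (C r i j : ℂ))
      (spectralDensity C ω i j) := by
  have hentry : ∀ i j, Summable
      fun r : ℤ => Complex.exp (Complex.I * (r : ℂ) * (ω : ℂ)) * (C r i j : ℂ) := by
    intro i j
    refine Summable.of_norm_bounded hC fun r => ?_
    have : Complex.I * (r : ℂ) * (ω : ℂ) = ((r * ω : ℝ) : ℂ) * Complex.I := by push_cast; ring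
    rw [norm_mul, this, Complex.norm_exp_ofReal_mul_I, one_mul, Complex.norm_real]
    exact abs_entry_le_specNorm _ _ _
  have hsum : Summable fun r : ℤ => Complex.exp (Complex.I * (r : ℂ) * (ω : ℂ)) •
      (C r).map (fun x : ℝ => (x : ℂ)) :=
    Pi.summable.2 fun i => Pi.summable.2 fun j => by
      simpa only [Matrix.smul_apply, Matrix.map_apply, smul_eq_mul] using hentry i j
  have := Pi.hasSum.1 (Pi.hasSum.1 hsum.hasSum i) j
  simpa only [spectralDensity, Matrix.smul_apply, Matrix.map_apply, smul_eq_mul] using this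

theorem isHermitian_spectralDensity {C : ℤ → Mat p} (hC : Summable fun r => specNorm (C r))
    (hsymm : ∀ r, C r = (C (-r)).transpose) (ω : ℝ) : (spectralDensity C ω).IsHermitian := by
  ext i j
  rw [Matrix.conjTranspose_apply]
  have h1 := ((Equiv.neg ℤ).hasSum_iff.2 (hasSum_spectralDensity_entry hC ω j i)).star
  refine h1.unique (?_ : HasSum _ (spectralDensity C ω i j))
  convert hasSum_spectralDensity_entry hC ω i j using 2 with r
  simp only [Function.comp_apply, Equiv.neg_apply]
  have hr : C r i j = C (-r) j i := by rw [hsymm r, Matrix.transpose_apply]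
  simp only [hr, star_mul', Complex.star_def, Complex.conj_ofReal, ← Complex.exp_conj, map_mul,
    Complex.conj_I, map_neg, map_intCast, Int.cast_neg]
  congr 2
  ring

open scoped ComplexOrder in
/-- The quadratic form of a Hermitian matrix is bounded below by the infimum of the spectrum. -/
theorem mul_dotProduct_le_of_spectrum {A : Matrix (Fin p) (Fin p) ℂ} (hA : A.IsHermitian) {γ : ℝ}
    (h : spectrum ℝ A ⊆ Set.Ici γ) (x : Fin p → ℂ) :
    γ * (∑ i, star (x i) * x i).re ≤ (∑ i, ∑ j, star (x i) * A i j * x j).re := by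
  have hγ : (algebraMap ℝ (Matrix (Fin p) (Fin p) ℂ) γ).IsHermitian := by
    rw [Matrix.IsHermitian, Algebra.algebraMap_eq_smul_one, Matrix.conjTranspose_smul]
    simp
  have hB := hA.sub hγ
  -- Subtracting `γ` shifts the spectrum into the nonnegative half-line.
  have hpos : (A - algebraMap ℝ _ γ).PosSemidef := by
    rw [hB.posSemidef_iff_eigenvalues_nonneg]
    intro i
    have hi : hB.eigenvalues i ∈ spectrum ℝ (A - algebraMap ℝ _ γ) := by
      rw [hB.spectrum_real_eq_range_eigenvalues]
      exact ⟨i, rfl⟩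
    rw [← spectrum.sub_singleton_eq] at hi
    obtain ⟨a, ha, b, rfl, hab⟩ := hi
    have := h ha
    simp only [Set.mem_Ici] at this
    simp only [Pi.zero_apply]
    linarith
  have h1 := hpos.re_dotProduct_nonneg x
  rw [Matrix.sub_mulVec, dotProduct_sub, Algebra.algebraMap_eq_smul_one, Matrix.smul_mulVec,
    Matrix.one_mulVec, dotProduct_smul, map_sub, sub_nonneg] at h1
  simp only [dotProduct, Matrix.mulVec, Pi.star_apply, Finset.mul_sum, ← mul_assoc,
    RCLike.re_to_complex, Complex.real_smul] at h1
  simpa [Finset.mul_sum, mul_add, mul_assoc] using h1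

theorem integral_cos_int_mul (k : ℤ) :
    ∫ ω in (0 : ℝ)..(2 * Real.pi), Real.cos (k * ω) = if k = 0 then 2 * Real.pi else 0 := by
  by_cases hk : k = 0
  · simp [hk]
  · have hk' : (k : ℝ) ≠ 0 := by exact_mod_cast hk
    rw [if_neg hk, intervalIntegral.integral_comp_mul_left (fun x => Real.cos x) hk', integral_cos]
    have : Real.sin (k * (2 * Real.pi)) = 0 := by
      have := Real.sin_int_mul_pi (k * 2)
      push_cast at this
      rwa [mul_assoc] at this
    simp [this]

/-- The quadratic form of a block Toeplitz matrix is bounded below by the infimum of the spectra of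
its symbol. -/
theorem toeplitz_lower_bound {C : ℤ → Mat p} (hC : Summable fun r => specNorm (C r))
    (hsymm : ∀ r, C r = (C (-r)).transpose) {γ : ℝ}
    (h : ∀ ω, spectrum ℝ (spectralDensity C ω) ⊆ Set.Ici γ) (F : Finset ℤ) (v : ℤ → Vec p) :
    γ * ∑ t ∈ F, ‖v t‖ ^ 2 ≤
      ∑ t ∈ F, ∑ τ ∈ F,
        inner ℝ (v t) (Matrix.toEuclideanCLM (n := Fin p) (𝕜 := ℝ) (C (t - τ)) (v τ)) := by
  set q : ℤ → ℤ → ℤ → ℝ := fun r t τ =>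
    inner ℝ (v t) (Matrix.toEuclideanCLM (n := Fin p) (𝕜 := ℝ) (C r) (v τ)) with hq
  -- With `x(ω) = ∑ v_t e^{itω}`, `Q r` is the real part of the contribution of `C_r` to `x* f x`,
  -- and `R` is `|x|²`. Integrating `γ |x|² ≤ x* f x` over a period leaves only `r = t - τ`.
  set Q : ℤ → ℝ → ℝ := fun r ω => ∑ t ∈ F, ∑ τ ∈ F, q r t τ * Real.cos ((r - t + τ : ℤ) * ω) with hQ
  set R : ℝ → ℝ := fun ω => ∑ t ∈ F, ∑ τ ∈ F, inner ℝ (v t) (v τ) * Real.cos ((τ - t : ℤ) * ω)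
    with hR
  set e : ℤ → ℝ → ℂ := fun k ω => Complex.exp (Complex.I * (k : ℂ) * (ω : ℂ)) with he
  have he_add : ∀ a b ω, e (a + b) ω = e a ω * e b ω := fun a b ω => by
    simp only [he]; rw [← Complex.exp_add]; push_cast; ring_nf
  have he_star : ∀ a ω, star (e a ω) = e (-a) ω := fun a ω => by
    simp only [he, Complex.star_def]; rw [← Complex.exp_conj]; simp
  have he_re : ∀ a ω, (e a ω).re = Real.cos (a * ω) := fun a ω => by
    have : Complex.I * (a : ℂ) * (ω : ℂ) = ((a * ω : ℝ) : ℂ) * Complex.I := by push_cast; ring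
    simp only [he]; rw [this, Complex.exp_ofReal_mul_I_re]
  set x : ℝ → Fin p → ℂ := fun ω i => ∑ t ∈ F, (v t i : ℂ) * e t ω with hx
  have hxx : ∀ ω i j, star (x ω i) * x ω j
      = ∑ t ∈ F, ∑ τ ∈ F, ((v t i * v τ j : ℝ) : ℂ) * e (τ - t) ω := by
    intro ω i j
    simp only [hx, star_sum, Finset.sum_mul_sum]
    refine Finset.sum_congr rfl fun t _ => Finset.sum_congr rfl fun τ _ => ?_
    rw [star_mul', he_star, sub_eq_add_neg, he_add, Complex.star_def, Complex.conj_ofReal]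
    push_cast
    ring
  have hHS : ∀ ω, HasSum (fun r => Q r ω)
      (∑ i, ∑ j, star (x ω i) * spectralDensity C ω i j * x ω j).re := by
    intro ω
    have h1 : HasSum (fun r => ∑ i, ∑ j, star (x ω i) * (e r ω * (C r i j : ℂ)) * x ω j)
        (∑ i, ∑ j, star (x ω i) * spectralDensity C ω i j * x ω j) :=
      hasSum_sum fun i _ => hasSum_sum fun j _ =>
        ((hasSum_spectralDensity_entry hC ω i j).mul_left _).mul_right _
    convert Complex.hasSum_re h1 using 2 with r
    have h2 : ∀ i j, star (x ω i) * (e r ω * (C r i j : ℂ)) * x ω j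
        = ∑ t ∈ F, ∑ τ ∈ F, ((v t i * v τ j * C r i j : ℝ) : ℂ) * e (r - t + τ) ω := by
      intro i j
      rw [show star (x ω i) * (e r ω * (C r i j : ℂ)) * x ω j
        = (star (x ω i) * x ω j) * (e r ω * (C r i j : ℂ)) by ring, hxx]
      simp only [Finset.sum_mul]
      refine Finset.sum_congr rfl fun t _ => Finset.sum_congr rfl fun τ _ => ?_
      rw [show r - t + τ = (τ - t) + r by ring, he_add]
      push_cast
      ring
    simp only [h2, Complex.re_sum, Complex.re_ofReal_mul, he_re]
    simp only [hQ, hq, inner_toEuclideanCLM, Finset.sum_mul]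
    exact Finset.sum_sum_comm_sum_sum ..
  have hRe : ∀ ω, (∑ i, star (x ω i) * x ω i).re = R ω := by
    intro ω
    simp only [hxx, Complex.re_sum, Complex.re_ofReal_mul, he_re, hR, PiLp.inner_apply,
      RCLike.inner_apply, conj_trivial, Finset.sum_mul]
    rw [Finset.sum_comm]
    refine Finset.sum_congr rfl fun t _ => ?_
    rw [Finset.sum_comm]
    refine Finset.sum_congr rfl fun τ _ => Finset.sum_congr rfl fun i _ => by ring
  have hle : ∀ ω, γ * R ω ≤ ∑' r, Q r ω := by
    intro ω
    rw [(hHS ω).tsum_eq, ← hRe]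
    exact mul_dotProduct_le_of_spectrum (isHermitian_spectralDensity hC hsymm ω) (h ω) (x ω)
  have hQc : ∀ r, Continuous (Q r) := fun r => by simp only [hQ]; fun_prop
  have hRc : Continuous R := by simp only [hR]; fun_prop
  set b : ℤ → ℝ := fun r => specNorm (C r) * ∑ t ∈ F, ∑ τ ∈ F, ‖v t‖ * ‖v τ‖ with hb
  have hbs : Summable b := hC.mul_right _
  have hQb : ∀ r ω, ‖Q r ω‖ ≤ b r := by
    intro r ω
    simp only [hQ, hb, Finset.mul_sum]
    refine (norm_sum_le _ _).trans (Finset.sum_le_sum fun t _ => ?_)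
    refine (norm_sum_le _ _).trans (Finset.sum_le_sum fun τ _ => ?_)
    rw [norm_mul, Real.norm_eq_abs, Real.norm_eq_abs]
    have h1 := abs_inner_toEuclideanCLM_le (C r) (v t) (v τ)
    have h2 := Real.abs_cos_le_one ((r - t + τ : ℤ) * ω)
    calc _ ≤ |q r t τ| * 1 := by gcongr
      _ ≤ _ := by simpa [hq] using h1
  -- Termwise integration is justified by the summable majorant `b`, uniform in `ω`.
  have hint : HasSum (fun r => ∫ ω in (0 : ℝ)..(2 * Real.pi), Q r ω)
      (∫ ω in (0 : ℝ)..(2 * Real.pi), ∑' r, Q r ω) := by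
    refine intervalIntegral.hasSum_integral_of_dominated_convergence (fun r _ => b r)
      (fun r => (hQc r).aestronglyMeasurable) ?_ ?_ ?_ ?_
    · exact fun r => Eventually.of_forall fun ω _ => hQb r ω
    · exact Eventually.of_forall fun _ _ => hbs
    · exact intervalIntegrable_const
    · exact Eventually.of_forall fun ω _ => (hHS ω).summable.hasSum
  have hQint : ∀ r, ∫ ω in (0 : ℝ)..(2 * Real.pi), Q r ω
      = ∑ t ∈ F, ∑ τ ∈ F, q r t τ * if r - t + τ = 0 then 2 * Real.pi else 0 := by
    intro r
    simp only [hQ]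
    rw [intervalIntegral.integral_finsetSum fun t _ =>
      Continuous.intervalIntegrable (by fun_prop) _ _]
    refine Finset.sum_congr rfl fun t _ => ?_
    rw [intervalIntegral.integral_finsetSum fun t _ =>
      Continuous.intervalIntegrable (by fun_prop) _ _]
    refine Finset.sum_congr rfl fun τ _ => ?_
    rw [intervalIntegral.integral_const_mul, integral_cos_int_mul]
  have hRint : ∫ ω in (0 : ℝ)..(2 * Real.pi), R ω = 2 * Real.pi * ∑ t ∈ F, ‖v t‖ ^ 2 := by
    simp only [hR]
    rw [intervalIntegral.integral_finsetSum fun t _ =>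
      Continuous.intervalIntegrable (by fun_prop) _ _, Finset.mul_sum]
    refine Finset.sum_congr rfl fun t ht => ?_
    rw [intervalIntegral.integral_finsetSum fun t _ =>
      Continuous.intervalIntegrable (by fun_prop) _ _, Finset.sum_eq_single t]
    · rw [intervalIntegral.integral_const_mul, integral_cos_int_mul, sub_self, if_pos rfl,
        real_inner_self_eq_norm_sq, mul_comm]
    · intro τ _ hτ
      rw [intervalIntegral.integral_const_mul, integral_cos_int_mul, if_neg (sub_ne_zero.2 hτ),
        mul_zero]
    · exact fun h => absurd ht h
  have htot : HasSum (fun r => ∫ ω in (0 : ℝ)..(2 * Real.pi), Q r ω)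
      (∑ t ∈ F, ∑ τ ∈ F, q (t - τ) t τ * (2 * Real.pi)) := by
    simp only [hQint]
    refine hasSum_sum fun t _ => hasSum_sum fun τ _ => ?_
    convert hasSum_single (t - τ) ?_ using 1
    · simp
    · intro r hr
      rw [if_neg (by omega), mul_zero]
  have hfin : ∫ ω in (0 : ℝ)..(2 * Real.pi), γ * R ω
      ≤ ∫ ω in (0 : ℝ)..(2 * Real.pi), ∑' r, Q r ω := by
    refine intervalIntegral.integral_mono (by positivity) ?_ ?_ hle
    · exact Continuous.intervalIntegrable (by fun_prop) _ _
    · refine Continuous.intervalIntegrable ?_ _ _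
      exact continuous_tsum hQc hbs hQb
  rw [intervalIntegral.integral_const_mul, hRint, hint.unique htot] at hfin
  simp only [← Finset.sum_mul] at hfin
  have hpi := Real.pi_pos
  nlinarith

end Toeplitz

/-! ### Block matrices as operators on `ℓ_{2,p}` -/

section BlockOperator

variable {p : ℕ}

/-- **Schur test** for the quadratic form of a finite section of a block matrix. -/
theorem abs_sum_inner_le_of_specNorm_le (F : Finset ℤ) (v : ℤ → Vec p) {M : ℤ → ℤ → Mat p}
    {k : ℤ → ℝ} (hk : Summable k) (hk0 : ∀ r, 0 ≤ k r)
    (hM : ∀ t ∈ F, ∀ τ ∈ F, specNorm (M t τ) ≤ k (t - τ)) :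
    |∑ t ∈ F, ∑ τ ∈ F, inner ℝ (v t) (Matrix.toEuclideanCLM (n := Fin p) (𝕜 := ℝ) (M t τ) (v τ))|
      ≤ (∑' r, k r) * ∑ t ∈ F, ‖v t‖ ^ 2 := by
  have hrow : ∀ t, ∑ τ ∈ F, k (t - τ) ≤ ∑' r, k r := fun t =>
    sum_le_hasSum F (fun _ _ => hk0 _) ((Equiv.subLeft t).hasSum_iff.2 hk.hasSum)
  have hcol : ∀ τ, ∑ t ∈ F, k (t - τ) ≤ ∑' r, k r := fun τ =>
    sum_le_hasSum F (fun _ _ => hk0 _) ((Equiv.subRight τ).hasSum_iff.2 hk.hasSum)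
  -- The inequality `2xy ≤ x² + y²` splits each term evenly into a row part and a column part.
  have hterm : ∀ t ∈ F, ∀ τ ∈ F,
      |inner ℝ (v t) (Matrix.toEuclideanCLM (n := Fin p) (𝕜 := ℝ) (M t τ) (v τ))|
        ≤ 2⁻¹ * (k (t - τ) * ‖v t‖ ^ 2) + 2⁻¹ * (k (t - τ) * ‖v τ‖ ^ 2) := by
    intro t ht τ hτ
    have h1 := abs_inner_toEuclideanCLM_le (M t τ) (v t) (v τ)
    have h2 := mul_le_mul_of_nonneg_right (hM t ht τ hτ)
      (mul_nonneg (norm_nonneg (v t)) (norm_nonneg (v τ)))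
    have h3 := mul_nonneg (hk0 (t - τ)) (sq_nonneg (‖v t‖ - ‖v τ‖))
    nlinarith
  calc _ ≤ ∑ t ∈ F, ∑ τ ∈ F, (2⁻¹ * (k (t - τ) * ‖v t‖ ^ 2) + 2⁻¹ * (k (t - τ) * ‖v τ‖ ^ 2)) :=
        (Finset.abs_sum_le_sum_abs _ _).trans <| Finset.sum_le_sum fun t ht =>
          (Finset.abs_sum_le_sum_abs _ _).trans <| Finset.sum_le_sum fun τ hτ => hterm t ht τ hτ
    _ = 2⁻¹ * (∑ t ∈ F, (∑ τ ∈ F, k (t - τ)) * ‖v t‖ ^ 2)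
        + 2⁻¹ * (∑ τ ∈ F, (∑ t ∈ F, k (t - τ)) * ‖v τ‖ ^ 2) := by
      simp only [Finset.sum_add_distrib, ← Finset.mul_sum, Finset.sum_mul]
      congr 2
      exact Finset.sum_comm
    _ ≤ 2⁻¹ * (∑ t ∈ F, (∑' r, k r) * ‖v t‖ ^ 2) + 2⁻¹ * (∑ τ ∈ F, (∑' r, k r) * ‖v τ‖ ^ 2) := by
      gcongr with t _ τ _
      exacts [hrow t, hcol τ]
    _ = _ := by rw [← Finset.mul_sum]; ring

/-- A single block diagonal of a block matrix, as a bounded operator on `ℓ_{2,p}`. -/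
theorem exists_blockDiagonal_clm (M : ℤ → ℤ → Mat p) (r : ℤ) {c : ℝ} (hc : 0 ≤ c)
    (hM : ∀ t, specNorm (M t (t - r)) ≤ c) :
    ∃ A : SeqSpace p →L[ℝ] SeqSpace p, ‖A‖ ≤ c ∧ ∀ v t,
      A v t = Matrix.toEuclideanCLM (n := Fin p) (𝕜 := ℝ) (M t (t - r)) (v (t - r)) := by
  have hsum : ∀ (v : SeqSpace p) (s : Finset ℤ),
      ∑ t ∈ s, ‖Matrix.toEuclideanCLM (n := Fin p) (𝕜 := ℝ) (M t (t - r)) (v (t - r))‖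
        ^ (2 : ENNReal).toReal ≤ (c * ‖v‖) ^ (2 : ENNReal).toReal := by
    intro v s
    simp only [ENNReal.toReal_ofNat, Real.rpow_two]
    have h1 := lp.sum_rpow_le_norm_rpow (p := 2) (by norm_num) v
      (s.map (Equiv.subRight r).toEmbedding)
    simp only [ENNReal.toReal_ofNat, Real.rpow_two, Finset.sum_map, Equiv.coe_toEmbedding,
      Equiv.subRight_apply] at h1
    calc _ ≤ ∑ t ∈ s, c ^ 2 * ‖v (t - r)‖ ^ 2 := by
          refine Finset.sum_le_sum fun t _ => ?_
          rw [← mul_pow]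
          refine pow_le_pow_left₀ (norm_nonneg _) ?_ 2
          refine (ContinuousLinearMap.le_opNorm _ _).trans ?_
          exact mul_le_mul_of_nonneg_right (hM t) (norm_nonneg _)
      _ ≤ _ := by
          rw [← Finset.mul_sum, mul_pow]
          exact mul_le_mul_of_nonneg_left h1 (sq_nonneg c)
  let A₀ : SeqSpace p →ₗ[ℝ] SeqSpace p :=
    { toFun := fun v => ⟨fun t => Matrix.toEuclideanCLM (n := Fin p) (𝕜 := ℝ) (M t (t - r))
        (v (t - r)), memℓp_gen' (hsum v)⟩
      map_add' := fun v w => by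
        ext1; funext t
        exact map_add (Matrix.toEuclideanCLM (n := Fin p) (𝕜 := ℝ) (M t (t - r))) _ _
      map_smul' := fun a v => by
        ext1; funext t
        exact map_smul (Matrix.toEuclideanCLM (n := Fin p) (𝕜 := ℝ) (M t (t - r))) a (v (t - r)) }
  refine ⟨A₀.mkContinuous c fun v => ?_, LinearMap.mkContinuous_norm_le _ hc _, fun v t => rfl⟩
  exact lp.norm_le_of_forall_sum_le (by norm_num) (by positivity) (hsum v)

/-- A block matrix with summable off-diagonal decay defines a bounded operator on `ℓ_{2,p}`. -/
theorem exists_isBlockMatrixOf {M : ℤ → ℤ → Mat p} {k : ℤ → ℝ} (hk : Summable k)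
    (hM : ∀ t τ, specNorm (M t τ) ≤ k (t - τ)) :
    ∃ T : SeqSpace p →L[ℝ] SeqSpace p, IsBlockMatrixOf M T := by
  have hM' : ∀ r t, specNorm (M t (t - r)) ≤ k r := fun r t => by
    simpa using hM t (t - r)
  choose A hA hA' using fun r => exists_blockDiagonal_clm M r
    ((specNorm_nonneg _).trans (hM' r 0)) (hM' r)
  -- The block diagonals are summed absolutely in operator norm.
  have hsA : Summable A := Summable.of_norm_bounded hk hA
  refine ⟨∑' r, A r, fun v t => ?_⟩
  have h1 : HasSum (fun r => A r v t) ((∑' r, A r) v t) := by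
    have h2 := (ContinuousLinearMap.apply ℝ (SeqSpace p) v).hasSum hsA.hasSum
    exact (lp.evalCLM ℝ (fun _ : ℤ => Vec p) 2 t).hasSum h2
  rw [← (Equiv.subLeft t).hasSum_iff] at h1
  convert h1 using 2 with τ
  simp [hA']

theorem IsBlockMatrixOf.apply_single {M : ℤ → ℤ → Mat p} {T : SeqSpace p →L[ℝ] SeqSpace p}
    (hT : IsBlockMatrixOf M T) (τ t : ℤ) (x : Vec p) :
    T (lp.single 2 τ x) t = Matrix.toEuclideanCLM (n := Fin p) (𝕜 := ℝ) (M t τ) x := by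
  refine (hT _ t).unique ?_
  convert hasSum_single τ ?_ using 1
  · simp
  · intro s hs
    rw [lp.single_apply_ne _ _ _ hs, map_zero]

/-- Bounds for the quadratic forms of the finite sections carry over to the operator. -/
theorem IsBlockMatrixOf.inner_bounds {M : ℤ → ℤ → Mat p} {T : SeqSpace p →L[ℝ] SeqSpace p}
    (hT : IsBlockMatrixOf M T) {a b : ℝ}
    (h : ∀ (F : Finset ℤ) (v : ℤ → Vec p), a * ∑ t ∈ F, ‖v t‖ ^ 2 ≤ ∑ t ∈ F, ∑ τ ∈ F,
        inner ℝ (v t) (Matrix.toEuclideanCLM (n := Fin p) (𝕜 := ℝ) (M t τ) (v τ)) ∧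
      ∑ t ∈ F, ∑ τ ∈ F, inner ℝ (v t) (Matrix.toEuclideanCLM (n := Fin p) (𝕜 := ℝ) (M t τ) (v τ))
        ≤ b * ∑ t ∈ F, ‖v t‖ ^ 2) (v : SeqSpace p) :
    a * ‖v‖ ^ 2 ≤ inner ℝ v (T v) ∧ inner ℝ v (T v) ≤ b * ‖v‖ ^ 2 := by
  -- Finite truncations converge to `v` in norm, so their quadratic forms converge by continuity of
  -- `T`.
  have h1 : Tendsto (fun F : Finset ℤ => ∑ t ∈ F, lp.single 2 t (v t)) atTop (𝓝 v) :=
    lp.hasSum_single (by norm_num) v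
  have h2 : Tendsto (fun F : Finset ℤ => ∑ t ∈ F, ‖v t‖ ^ 2) atTop (𝓝 (‖v‖ ^ 2)) := by
    have := lp.hasSum_norm (p := 2) (by norm_num) v
    simp only [ENNReal.toReal_ofNat, Real.rpow_two] at this
    exact this
  have h3 := h1.inner (𝕜 := ℝ) ((T.continuous.tendsto v).comp h1)
  have h4 : ∀ F : Finset ℤ, (inner ℝ (∑ t ∈ F, lp.single 2 t (v t))
      (T (∑ t ∈ F, lp.single 2 t (v t))) : ℝ) = ∑ t ∈ F, ∑ τ ∈ F,
        inner ℝ (v t) (Matrix.toEuclideanCLM (n := Fin p) (𝕜 := ℝ) (M t τ) (v τ)) := by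
    intro F
    rw [map_sum, sum_inner]
    refine Finset.sum_congr rfl fun t _ => ?_
    rw [inner_sum]
    refine Finset.sum_congr rfl fun τ _ => ?_
    rw [lp.inner_single_left, hT.apply_single]
  simp only [Function.comp_def, h4] at h3
  exact ⟨le_of_tendsto_of_tendsto' (h2.const_mul a) h3 fun F => (h F v).1,
    le_of_tendsto_of_tendsto' h3 (h2.const_mul b) fun F => (h F v).2⟩

end BlockOperator

/-! ### Localization by windows and the eigenvalue bounds -/

section Windows

variable {p : ℕ}

/-- The window positions `s` with `t ∈ [s, s + L)`. -/
noncomputable def windowsAt (L : ℕ) (t : ℤ) : Finset ℤ := Finset.Ioc (t - L) t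

theorem card_windowsAt (L : ℕ) (t : ℤ) : (windowsAt L t).card = L := by
  simp [windowsAt]

theorem sub_abs_le_card_windowsAt_inter (L : ℕ) (t τ : ℤ) :
    (L : ℝ) - |((t - τ : ℤ) : ℝ)| ≤ ((windowsAt L t ∩ windowsAt L τ).card : ℝ) := by
  have h : windowsAt L t ∩ windowsAt L τ = Finset.Ioc (max (t - L) (τ - L)) (min t τ) := by
    simp [windowsAt, Finset.Ioc_inter_Ioc]
  rw [h, Int.card_Ioc]
  have h1 : (L : ℤ) - |t - τ| ≤ ((min t τ - max (t - L) (τ - L)).toNat : ℤ) := by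
    rcases le_total t τ with h | h
    · rw [abs_of_nonpos (by omega)]; omega
    · rw [abs_of_nonneg (by omega)]; omega
  exact_mod_cast h1

/-- Averaging stationary approximations over all windows of length `L` that contain both `t` and `τ`
approximates a locally stationary block matrix. -/
theorem specNorm_sub_window_average_le {D : ℤ → ℤ → Mat p} {C : ℤ → ℝ → Mat p} {K κ : ℝ}
    {N : ℕ} (hN : 1 ≤ N) {L : ℕ} (hL : 1 ≤ L) (hK : 0 ≤ K)
    (hD : ∀ t τ, specNorm (D t τ) ≤ K * gu (t - τ) ^ (-κ))
    (hC : ∀ r u v, specNorm (C r u - C r v) ≤ K * |u - v| * gu r ^ (-κ))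
    (hDC : ∀ t τ : ℤ, specNorm (D t τ - C (t - τ) ((t : ℝ) / N))
      ≤ K * (N : ℝ)⁻¹ * gu (t - τ) ^ (1 - κ)) (t τ : ℤ) :
    specNorm (D t τ - (L : ℝ)⁻¹ • ∑ s ∈ windowsAt L t ∩ windowsAt L τ, C (t - τ) ((s : ℝ) / N))
      ≤ K * ((L : ℝ)⁻¹ + (1 + L) * (N : ℝ)⁻¹) * gu (t - τ) ^ (1 - κ) := by
  set I := windowsAt L t ∩ windowsAt L τ with hI
  have hL0 : (0 : ℝ) < L := by exact_mod_cast hL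
  have hN0 : (0 : ℝ) < N := by exact_mod_cast hN
  have hgu := gu_pos (t - τ)
  have hg0 : 0 ≤ gu (t - τ) ^ (-κ) := Real.rpow_nonneg hgu.le _
  have hg1 : gu (t - τ) ^ (1 - κ) = gu (t - τ) * gu (t - τ) ^ (-κ) := by
    rw [sub_eq_add_neg 1 κ, Real.rpow_add hgu, Real.rpow_one]
  have hg2 : gu (t - τ) ^ (-κ) ≤ gu (t - τ) ^ (1 - κ) := by
    rw [hg1]; exact le_mul_of_one_le_left hg0 (one_le_gu _)
  have hcard : (I.card : ℝ) ≤ L := by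
    have := (Finset.card_le_card (Finset.inter_subset_left (s₁ := windowsAt L t)
      (s₂ := windowsAt L τ))).trans_eq (card_windowsAt L t)
    exact_mod_cast this
  have hcard' := sub_abs_le_card_windowsAt_inter L t τ
  rw [← hI] at hcard'
  -- Of the `L` windows at `t`, those missing `τ` number at most `|t - τ|`; they are charged to `D`
  -- itself, the others to the approximation error.
  have hdec : D t τ - (L : ℝ)⁻¹ • ∑ s ∈ I, C (t - τ) ((s : ℝ) / N)
      = (L : ℝ)⁻¹ • (((L : ℝ) - I.card) • D t τ
        + ∑ s ∈ I, (D t τ - C (t - τ) ((s : ℝ) / N))) := by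
    rw [Finset.sum_sub_distrib, Finset.sum_const, ← Nat.cast_smul_eq_nsmul ℝ, sub_smul,
      sub_add_sub_cancel, smul_sub, smul_smul, inv_mul_cancel₀ hL0.ne', one_smul]
  -- The `1` is the error at `t/N`, the `L` the cost of moving `t/N` to `s/N` inside a window.
  have hs : ∀ s ∈ I, specNorm (D t τ - C (t - τ) ((s : ℝ) / N))
      ≤ K * ((1 + L) * (N : ℝ)⁻¹) * gu (t - τ) ^ (1 - κ) := by
    intro s hs
    have hs' := Finset.mem_Ioc.1 (Finset.mem_inter.1 hs).1
    have habs : |(t : ℝ) / N - (s : ℝ) / N| ≤ L * (N : ℝ)⁻¹ := by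
      rw [← sub_div, div_eq_mul_inv, abs_mul, abs_of_pos (inv_pos.2 hN0)]
      refine mul_le_mul_of_nonneg_right ?_ (inv_pos.2 hN0).le
      have : |t - s| ≤ (L : ℤ) := abs_le.2 ⟨by omega, by omega⟩
      exact_mod_cast this
    calc _ = specNorm ((D t τ - C (t - τ) ((t : ℝ) / N))
          + (C (t - τ) ((t : ℝ) / N) - C (t - τ) ((s : ℝ) / N))) := by rw [sub_add_sub_cancel]
      _ ≤ K * (N : ℝ)⁻¹ * gu (t - τ) ^ (1 - κ)
          + K * |(t : ℝ) / N - (s : ℝ) / N| * gu (t - τ) ^ (-κ) :=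
        (specNorm_add_le _ _).trans (add_le_add (hDC t τ) (hC _ _ _))
      _ ≤ K * (N : ℝ)⁻¹ * gu (t - τ) ^ (1 - κ) + K * (L * (N : ℝ)⁻¹) * gu (t - τ) ^ (1 - κ) := by
        gcongr
      _ = _ := by ring
  have hsumle : specNorm (∑ s ∈ I, (D t τ - C (t - τ) ((s : ℝ) / N)))
      ≤ I.card • (K * ((1 + L) * (N : ℝ)⁻¹) * gu (t - τ) ^ (1 - κ)) := by
    refine le_trans ?_ (Finset.sum_le_card_nsmul I _ _ hs)
    unfold specNorm
    rw [map_sum]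
    exact norm_sum_le _ _
  rw [nsmul_eq_mul] at hsumle
  have hB0 : 0 ≤ K * ((1 + L) * (N : ℝ)⁻¹) * gu (t - τ) ^ (1 - κ) := by
    have := hg0.trans hg2
    positivity
  have hdiag : specNorm (((L : ℝ) - I.card) • D t τ) ≤ K * gu (t - τ) ^ (1 - κ) := by
    rw [specNorm_smul, abs_of_nonneg (sub_nonneg.2 hcard), hg1]
    calc _ ≤ gu (t - τ) * (K * gu (t - τ) ^ (-κ)) :=
          mul_le_mul (by linarith [abs_le_gu (t - τ)]) (hD t τ) (specNorm_nonneg _) hgu.le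
      _ = _ := by ring
  rw [hdec, specNorm_smul, abs_of_pos (inv_pos.2 hL0)]
  calc _ ≤ (L : ℝ)⁻¹ * (K * gu (t - τ) ^ (1 - κ)
        + L * (K * ((1 + L) * (N : ℝ)⁻¹) * gu (t - τ) ^ (1 - κ))) := by
        refine mul_le_mul_of_nonneg_left ?_ (inv_pos.2 hL0).le
        refine (specNorm_add_le _ _).trans (add_le_add hdiag (hsumle.trans ?_))
        exact mul_le_mul_of_nonneg_right hcard hB0
    _ = _ := by field_simp

/-- The window average of positive Toeplitz forms is positive. -/
theorem window_average_lower_bound {C : ℤ → ℝ → Mat p} {γ : ℝ} {N L : ℕ} (hL : 1 ≤ L)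
    (hC : ∀ (u : ℝ) (F : Finset ℤ) (v : ℤ → Vec p), γ * ∑ t ∈ F, ‖v t‖ ^ 2 ≤
      ∑ t ∈ F, ∑ τ ∈ F,
        inner ℝ (v t) (Matrix.toEuclideanCLM (n := Fin p) (𝕜 := ℝ) (C (t - τ) u) (v τ)))
    (F : Finset ℤ) (v : ℤ → Vec p) :
    γ * ∑ t ∈ F, ‖v t‖ ^ 2 ≤ ∑ t ∈ F, ∑ τ ∈ F,
      inner ℝ (v t) (Matrix.toEuclideanCLM (n := Fin p) (𝕜 := ℝ)
        ((L : ℝ)⁻¹ • ∑ s ∈ windowsAt L t ∩ windowsAt L τ, C (t - τ) ((s : ℝ) / N)) (v τ)) := by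
  have hL0 : (0 : ℝ) < L := by exact_mod_cast hL
  set W := F.biUnion (windowsAt L) with hW
  have hsub : ∀ t ∈ F, windowsAt L t ⊆ W := fun t ht => Finset.subset_biUnion_of_mem _ ht
  -- The form at `s/N` is tested on `v` cut off to the window at `s`. Summing over `s` counts each
  -- `t` exactly `L` times, and each pair once per common window.
  have h1 := Finset.sum_le_sum fun s (_ : s ∈ W) =>
    hC ((s : ℝ) / N) F fun t => if s ∈ windowsAt L t then v t else 0
  have hl : ∑ s ∈ W, γ * ∑ t ∈ F, ‖if s ∈ windowsAt L t then v t else 0‖ ^ 2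
      = L * (γ * ∑ t ∈ F, ‖v t‖ ^ 2) := by
    rw [← Finset.mul_sum, Finset.sum_comm, mul_left_comm, Finset.mul_sum (s := F) (a := (L : ℝ))]
    congr 1
    refine Finset.sum_congr rfl fun t ht => ?_
    have : ∀ s, ‖if s ∈ windowsAt L t then v t else 0‖ ^ 2
        = if s ∈ windowsAt L t then ‖v t‖ ^ 2 else 0 := fun s => by split_ifs <;> simp
    simp only [this]
    rw [← Finset.sum_filter, Finset.filter_mem_eq_inter, Finset.inter_eq_right.2 (hsub t ht),
      Finset.sum_const, card_windowsAt, nsmul_eq_mul]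
  have hr : ∑ s ∈ W, ∑ t ∈ F, ∑ τ ∈ F,
      inner ℝ (if s ∈ windowsAt L t then v t else 0) (Matrix.toEuclideanCLM (n := Fin p) (𝕜 := ℝ)
        (C (t - τ) ((s : ℝ) / N)) (if s ∈ windowsAt L τ then v τ else 0))
      = L * ∑ t ∈ F, ∑ τ ∈ F,
      inner ℝ (v t) (Matrix.toEuclideanCLM (n := Fin p) (𝕜 := ℝ)
        ((L : ℝ)⁻¹ • ∑ s ∈ windowsAt L t ∩ windowsAt L τ, C (t - τ) ((s : ℝ) / N)) (v τ)) := by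
    rw [Finset.sum_comm, Finset.mul_sum]
    refine Finset.sum_congr rfl fun t ht => ?_
    rw [Finset.sum_comm, Finset.mul_sum]
    refine Finset.sum_congr rfl fun τ hτ => ?_
    rw [map_smul, map_sum, smul_apply, sum_apply,
      inner_smul_right, inner_sum, mul_inv_cancel_left₀ hL0.ne']
    have : ∀ s, (inner ℝ (if s ∈ windowsAt L t then v t else 0)
        (Matrix.toEuclideanCLM (n := Fin p) (𝕜 := ℝ)
        (C (t - τ) ((s : ℝ) / N)) (if s ∈ windowsAt L τ then v τ else 0)) : ℝ)
        = if s ∈ windowsAt L t ∩ windowsAt L τ then inner ℝ (v t)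
          (Matrix.toEuclideanCLM (n := Fin p) (𝕜 := ℝ) (C (t - τ) ((s : ℝ) / N)) (v τ))
          else 0 := fun s => by
      by_cases h1 : s ∈ windowsAt L t <;> by_cases h2 : s ∈ windowsAt L τ <;> simp [h1, h2]
    simp only [this]
    rw [← Finset.sum_filter, Finset.filter_mem_eq_inter,
      Finset.inter_eq_right.2 (Finset.inter_subset_left.trans (hsub t ht))]
  rw [hl, hr] at h1
  exact le_of_mul_le_mul_left h1 hL0

/-- Covariance decay, smoothness and a uniformly positive spectral density give the eigenvalue
condition. -/
theorem exists_eigenvalueCondition {CN : ℕ → ℤ → ℤ → Mat p} {C : ℤ → ℝ → Mat p} {K κ : ℝ}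
    (hK : 0 < K) (hκ : 2 < κ) (hdecay : CovarianceDecay CN K κ) (hsm : SmoothnessCondition CN C K κ)
    {γ : ℝ} (hγ : 0 < γ)
    (hspec : ∀ u ω : ℝ, spectrum ℝ (spectralDensity (fun r => C r u) ω) ⊆ Set.Ici γ) :
    ∃ (N₀ : ℕ) (a b : ℝ), EigenvalueCondition CN N₀ a b := by
  have hdiv : ∀ (c : ℝ) (r : ℤ), c / gu r ^ κ = c * gu r ^ (-κ) := fun c r => by
    rw [Real.rpow_neg (gu_pos r).le, div_eq_mul_inv]
  have hs0 : Summable fun r : ℤ => gu r ^ (-κ) := summable_gu_rpow (by linarith)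
  -- The lost power of the weight is what requires `κ > 2`.
  have hs1 : Summable fun r : ℤ => gu r ^ (1 - κ) := by
    simpa using summable_gu_rpow (κ := κ - 1) (by linarith)
  set S := ∑' r : ℤ, gu r ^ (1 - κ) with hS
  have hS0 : 0 ≤ S := tsum_nonneg fun r => Real.rpow_nonneg (gu_pos r).le _
  -- `L` is chosen before `N₀`: the error is `K S (1/L + (1+L)/N)`, and each of the two choices
  -- makes one summand at most `γ/4`.
  obtain ⟨L, hL⟩ := exists_nat_ge (max 1 (4 * K * S / γ))
  have hL1 : 1 ≤ L := by exact_mod_cast (le_max_left _ _).trans hL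
  have hL0 : (0 : ℝ) < L := by exact_mod_cast hL1
  have hLS : K * S * (L : ℝ)⁻¹ ≤ γ / 4 := by
    have := (div_le_iff₀ hγ).1 ((le_max_right _ _).trans hL)
    rw [← div_eq_mul_inv, div_le_iff₀ hL0]
    linarith
  obtain ⟨N₀, hN₀⟩ := exists_nat_ge (max 1 (4 * K * S * (1 + L) / γ))
  have hN₀1 : 1 ≤ N₀ := by exact_mod_cast (le_max_left _ _).trans hN₀
  refine ⟨N₀, γ / 2, ∑' r : ℤ, K * gu r ^ (-κ), hN₀1, by positivity, fun N hN => ?_⟩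
  have hN1 : 1 ≤ N := hN₀1.trans hN
  have hN0 : (0 : ℝ) < N := by exact_mod_cast hN1
  have hNS : K * S * ((1 + L) * (N : ℝ)⁻¹) ≤ γ / 4 := by
    have h1 := (div_le_iff₀ hγ).1 ((le_max_right _ _).trans hN₀)
    have h2 : (N₀ : ℝ) ≤ N := by exact_mod_cast hN
    rw [← mul_assoc, ← div_eq_mul_inv, div_le_iff₀ hN0]
    nlinarith
  have hD : ∀ t τ, specNorm (CN N t τ) ≤ K * gu (t - τ) ^ (-κ) := fun t τ => by
    rw [← hdiv]; exact hdecay N hN1 t τ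
  obtain ⟨T, hT⟩ := exists_isBlockMatrixOf (hs0.mul_left K) hD
  refine ⟨T, hT, fun v hv => ?_⟩
  have hb := hT.inner_bounds (a := γ / 2) (b := ∑' r : ℤ, K * gu r ^ (-κ)) ?_ v
  · simpa [hv] using hb
  intro F v
  have hV : 0 ≤ ∑ t ∈ F, ‖v t‖ ^ 2 := Finset.sum_nonneg fun _ _ => by positivity
  constructor
  · have hDC : ∀ t τ : ℤ, specNorm (CN N t τ - C (t - τ) ((t : ℝ) / N))
        ≤ K * (N : ℝ)⁻¹ * gu (t - τ) ^ (1 - κ) := fun t τ => by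
      have hg := Real.rpow_nonneg (gu_pos (t - τ)).le (1 - κ)
      refine (hsm.approx N hN1 t τ).trans ?_
      rw [div_eq_mul_inv, ← Real.rpow_neg (gu_pos _).le, neg_sub, mul_right_comm, ← one_div]
      exact mul_le_mul_of_nonneg_right (mul_le_mul_of_nonneg_left (min_le_left _ _) hK.le) hg
    have hM := specNorm_sub_window_average_le hN1 hL1 hK.le hD
      (fun r u v => by rw [← hdiv]; exact hsm.lipschitz r u v) hDC
    have hε0 : 0 ≤ K * ((L : ℝ)⁻¹ + (1 + L) * (N : ℝ)⁻¹) := by positivity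
    have h1 := abs_sum_inner_le_of_specNorm_le F v
      (M := fun t τ => CN N t τ
        - (L : ℝ)⁻¹ • ∑ s ∈ windowsAt L t ∩ windowsAt L τ, C (t - τ) ((s : ℝ) / N))
      (hs1.mul_left (K * ((L : ℝ)⁻¹ + (1 + L) * (N : ℝ)⁻¹)))
      (fun r => mul_nonneg hε0 (Real.rpow_nonneg (gu_pos r).le _)) (fun t _ τ _ => hM t τ)
    have h2 := window_average_lower_bound (N := N) hL1 (fun u => toeplitz_lower_bound
      (Summable.of_nonneg_of_le (fun r => specNorm_nonneg _)
        (fun r => (hsm.decay r u).trans_eq (hdiv K r)) (hs0.mul_left K))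
      (fun r => hsm.symm r u) (hspec u)) F v
    simp only [map_sub, sub_apply, inner_sub_right,
      Finset.sum_sub_distrib] at h1
    rw [tsum_mul_left, ← hS] at h1
    have h3 := (abs_le.1 h1).1
    have h4 : K * ((L : ℝ)⁻¹ + (1 + L) * (N : ℝ)⁻¹) * S ≤ γ / 2 := by linarith
    have h5 := mul_le_mul_of_nonneg_right h4 hV
    linarith
  · refine (le_abs_self _).trans (abs_sum_inner_le_of_specNorm_le F v (hs0.mul_left K)
      (fun r => mul_nonneg hK.le (Real.rpow_nonneg (gu_pos r).le _)) fun t _ τ _ => hD t τ)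

end Windows

/-! ### The main theorem -/

theorem mainTheorem8 {p : ℕ} {Ω : Type*} [MeasurableSpace Ω] (P : Measure Ω)
    [IsProbabilityMeasure P]
    -- the innovations and their independent copy
    (ε ε' : ℤ → Ω → Vec p) (hε : IIDWithCopy P ε ε')
    -- the causal maps of the array (first index `N`, then `t`) and of its stationary approximation
    (GN : ℕ → ℤ → (ℕ → Vec p) → Vec p) (G : ℝ → (ℕ → Vec p) → Vec p)
    (hGN : ∀ N : ℕ, 1 ≤ N → ∀ t : ℤ, Measurable (GN N t))
    (hG : ∀ u : ℝ, Measurable (G u))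
    -- the processes `X_{t,N} = G_{t,N}(F_t)` and `X_t(u) = G(u, F_t)`
    (X : ℕ → ℤ → Ω → Vec p) (hX : X = fun N t ω => GN N t (past ε t ω))
    (Y : ℝ → ℤ → Ω → Vec p) (hY : Y = fun u t ω => G u (past ε t ω))
    (hX2 : ∀ N : ℕ, 1 ≤ N → ∀ t : ℤ, MemLp (X N t) 2 P)
    (hY2 : ∀ (u : ℝ) (t : ℤ), MemLp (Y u t) 2 P)
    (hX0 : ∀ N : ℕ, 1 ≤ N → ∀ t : ℤ, ∫ ω, X N t ω ∂P = 0)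
    -- condition (A)
    (K κ : ℝ) (hκ : 3 < κ)
    (hA₁ : ∀ N : ℕ, 1 ≤ N → ∀ (t : ℤ) (j : ℕ),
      physDep P ε ε' (GN N t) t j ≤ K * gu j ^ (-κ))
    (hA₂ : ∀ (u : ℝ) (t : ℤ) (j : ℕ), physDep P ε ε' (G u) t j ≤ K * gu j ^ (-κ))
    (hA₃ : ∀ (v₁ v₂ : ℝ) (t : ℤ) (j : ℕ),
      physDep P ε ε' (fun F => G v₁ F - G v₂ F) t j ≤ K * |v₁ - v₂| * gu j ^ (-κ))
    (hA₄ : ∀ N : ℕ, 1 ≤ N → ∀ (t : ℤ) (j : ℕ),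
      physDep P ε ε' (fun F => GN N t F - G ((t : ℝ) / (N : ℝ)) F) t j
        ≤ K * (N : ℝ)⁻¹ * gu j ^ (-κ))
    -- the covariances `C^{(N)}_{t,τ}` and `C_r(u)`
    (CN : ℕ → ℤ → ℤ → Mat p) (hCN : CN = fun N t τ => covMat P (X N t) (X N τ))
    (C : ℤ → ℝ → Mat p) (hC : C = fun r u => covMat P (Y u r) (Y u 0))
    -- condition (B): the eigenvalues of all `f(ω; u)` lie in one interval `[γ₁, γ₂]`, `γ₁ > 0`
    (hB : ∃ γ₁ γ₂ : ℝ, 0 < γ₁ ∧ ∀ u ω : ℝ,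
      spectrum ℝ (spectralDensity (fun r => C r u) ω) ⊆ Set.Icc γ₁ γ₂) :
    (∃ K' : ℝ, 0 < K' ∧ CovarianceDecay CN K' κ ∧ SmoothnessCondition CN C K' κ) ∧
      ∃ (N₀ : ℕ) (a b : ℝ), EigenvalueCondition CN N₀ a b := by
  subst hX hY hCN hC
  obtain ⟨K', hK', hdecay, hsm⟩ :=
    covarianceDecay_and_smoothness hε hGN hG hX2 hY2 (by linarith) hA₁ hA₂ hA₃ hA₄
  obtain ⟨γ₁, γ₂, hγ₁, hspec⟩ := hB
  exact ⟨⟨K', hK', hdecay, hsm⟩, exists_eigenvalueCondition hK' (by linarith) hdecay hsm hγ₁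
    fun u ω => (hspec u ω).trans Set.Icc_subset_Ici_self⟩
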